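/- Let $f:(0,1)\times\mathbb R\to\mathbb R$ be an arbitrary function and let $\kappa_0,\kappa_1\in\mathbb R$. For $v\in BV(0,1)$ write $Dv=D^av\,dx+D^sv$ for the Lebesgue decomposition of the distributional derivative of $v$ into its absolutely continuous part, with density $D^av$, and its singular part $D^sv$; let $\frac{D^sv}{|D^sv|}$ be the density of $D^sv$ with respect to its total variation $|D^sv|$, and let $v(x^\pm)$ be the one-sided traces of $v$; put $\mathrm{sgn}(0)=0$. A function $u\in BV(0,1)$ is called a bounded variation solution of the Dirichlet problem $$-\Big(\frac{u'}{\sqrt{1+(u')^2}}\Big)'=f(x,u)\ \text{ in } (0,1),\qquad u(0)=\kappa_0,\quad u(1)=\kappa_1, \tag{1}$$ if $f(\cdot,u(\cdot))\in L^1(0,1)$ and $$\int_0^1\frac{D^au\,D^a\phi}{\sqrt{1+(D^au)^2}}\,dx+\int_0^1\frac{D^su}{|D^su|}\,D^s\phi+\mathrm{sgn}(u(0^+)-\kappa_0)\,\phi(0^+)+\mathrm{sgn}(u(1^-)-\kappa_1)\,\phi(1^-)=\int_0^1 f(x,u(x))\,\phi(x)\,dx$$ for all $\phi\in BV(0,1)$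 such that $|D^s\phi|$ is absolutely continuous with respect to $|D^su|$, $\phi(0^+)=0$ if $u(0^+)=\kappa_0$, and $\phi(1^-)=0$ if $u(1^-)=\kappa_1$. **Theorem 4.1.** Let $u$ be a bounded variation solution of (1). Assume that - (k) $f(x,u(x))\ge 0$ for almost all $x\in(0,1)$; - (kk) there exist $\delta\in(0,1]$ and $\mu_0\in L^1(0,\delta)$ such that $f(x,u(x))\le\mu_0(x)$ for almost all $x\in(0,\delta)$, $M_0(x):=\int_0^x\mu_0(t)\,dt>0$ for all $x\in(0,\delta]$, and $\int_0^\delta \frac{dx}{\sqrt{M_0(x)}}=+\infty$; - (kkk) there exist $\delta\in(0,1]$ and $\mu_1\in L^1(1-\delta,1)$ such that $f(x,u(x))\le\mu_1(x)$ for almost all $x\in(1-\delta,1)$, $M_1(x):=\int_x^1\mu_1(t)\,dt>0$ for all $x\in[1-\delta,1)$, and $\int_{1-\delta}^1 \frac{dx}{\sqrt{M_1(x)}}=+\infty$. Then $u\in W^{2,1}(0,1)$. Moreover, $u$ satisfies the differential equation in (1) almost everywhere in $(0,1)$ as well as the boundary conditions $u(0)=\kappa_0$ and $u(1)=\kappa_1$.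 -/

import Mathlib

open MeasureTheory Set Filter Topology
open scoped ContDiff

noncomputable section

namespace CurvatureBV

/-- Test functions on the open interval `(a, b)`: smooth, with compact support in `(a, b)`. -/
def IsTestFunction (a b : ℝ) (φ : ℝ → ℝ) : Prop :=
  ContDiff ℝ ∞ φ ∧ HasCompactSupport φ ∧ tsupport φ ⊆ Ioo a b

/-- `g` is a weak derivative of `v` on `(a, b)`. Functions on `(a, b)` are represented by functions
on `ℝ`, of which only the values on `(a, b)` matter. -/
def HasWeakDeriv (a b : ℝ) (v g : ℝ → ℝ) : Prop :=
  LocallyIntegrableOn v (Ioo a b) ∧ LocallyIntegrableOn g (Ioo a b) ∧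
    ∀ φ, IsTestFunction a b φ →
      ∫ x in Ioo a b, v x * deriv φ x = -∫ x in Ioo a b, g x * φ x

/-- The Sobolev space `W^{2,1}(a, b)`: functions in `L¹(a, b)` with first and second weak
derivatives in `L¹(a, b)`. -/
def MemW21 (a b : ℝ) (v : ℝ → ℝ) : Prop :=
  ∃ v₁ v₂ : ℝ → ℝ, HasWeakDeriv a b v v₁ ∧ HasWeakDeriv a b v₁ v₂ ∧
    IntegrableOn v (Ioo a b) ∧ IntegrableOn v₁ (Ioo a b) ∧ IntegrableOn v₂ (Ioo a b)

/-- `v ∈ BV(a, b)` with `Dv = ν`: the function `v` is in `L¹(a, b)` and its distributional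
derivative on `(a, b)` is the finite signed measure `ν`, here regarded as a measure on `ℝ`
concentrated on `(a, b)`. -/
def HasMeasureDeriv (a b : ℝ) (v : ℝ → ℝ) (ν : SignedMeasure ℝ) : Prop :=
  IntegrableOn v (Ioo a b) ∧ ν.restrict (Ioo a b) = ν ∧
    ∀ φ, IsTestFunction a b φ →
      ∫ x in Ioo a b, v x * deriv φ x = -ν.integral φ (ContinuousLinearMap.lsmul ℝ ℝ).flip

/-- Density of the absolutely continuous part of `ν` with respect to the Lebesgue measure. -/
def acDensity (ν : SignedMeasure ℝ) : ℝ → ℝ := ν.rnDeriv volume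

/-- Singular part of `ν` with respect to the Lebesgue measure. -/
def singPart (ν : SignedMeasure ℝ) : SignedMeasure ℝ := ν.singularPart volume

/-- The density `σ / |σ|` of a signed measure with respect to its total variation. -/
def polarDensity (σ : SignedMeasure ℝ) : ℝ → ℝ := σ.rnDeriv σ.totalVariation

/-- `l` is the right trace `v(x⁺)`: the one-sided essential limit. -/
def HasRightTrace (v : ℝ → ℝ) (x l : ℝ) : Prop :=
  Tendsto v (𝓝[>] x ⊓ ae volume) (𝓝 l)

/-- `l` is the left trace `v(x⁻)`: the one-sided essential limit. -/
def HasLeftTrace (v : ℝ → ℝ) (x l : ℝ) : Prop :=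
  Tendsto v (𝓝[<] x ⊓ ae volume) (𝓝 l)

/-- The right trace `v(x⁺)`; it exists for every `v ∈ BV(a, b)` and `x ∈ [a, b)`. -/
def rightTrace (v : ℝ → ℝ) (x : ℝ) : ℝ := limUnder (𝓝[>] x ⊓ ae volume) v

/-- The left trace `v(x⁻)`; it exists for every `v ∈ BV(a, b)` and `x ∈ (a, b]`. -/
def leftTrace (v : ℝ → ℝ) (x : ℝ) : ℝ := limUnder (𝓝[<] x ⊓ ae volume) v

/-- `u` is a bounded variation solution of the Dirichlet problem
`-(u' / √(1 + u'²))' = f(x, u)` in `(0, 1)`, `u(0) = κ₀`, `u(1) = κ₁`.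
The measure `ν` is `Du` (which is unique) and `η` is `Dφ`. -/
def IsBVSolutionDirichlet (f : ℝ → ℝ → ℝ) (κ₀ κ₁ : ℝ) (u : ℝ → ℝ) : Prop :=
  IntegrableOn (fun x => f x (u x)) (Ioo 0 1) ∧
  ∃ ν : SignedMeasure ℝ, HasMeasureDeriv 0 1 u ν ∧
    ∀ (φ : ℝ → ℝ) (η : SignedMeasure ℝ), HasMeasureDeriv 0 1 φ η →
      (singPart η).totalVariation ≪ (singPart ν).totalVariation →
      (rightTrace u 0 = κ₀ → rightTrace φ 0 = 0) →
      (leftTrace u 1 = κ₁ → leftTrace φ 1 = 0) →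
      (∫ x in Ioo (0 : ℝ) 1, acDensity ν x * acDensity η x / √(1 + acDensity ν x ^ 2))
        + (singPart η).integral (polarDensity (singPart ν)) (ContinuousLinearMap.lsmul ℝ ℝ).flip
        + Real.sign (rightTrace u 0 - κ₀) * rightTrace φ 0
        + Real.sign (leftTrace u 1 - κ₁) * leftTrace φ 1
        = ∫ x in Ioo (0 : ℝ) 1, f x (u x) * φ x

/-- `u` satisfies `-(u' / √(1 + u'²))' = f(x, u)` almost everywhere in `(a, b)`, where both
derivatives are functions: `u'` is the weak derivative of `u`, and `w` that of
`u' / √(1 + u'²)`. -/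
def SolvesCurvatureEqAE (a b : ℝ) (f : ℝ → ℝ → ℝ) (u : ℝ → ℝ) : Prop :=
  ∃ u' w : ℝ → ℝ, HasWeakDeriv a b u u' ∧
    HasWeakDeriv a b (fun x => u' x / √(1 + u' x ^ 2)) w ∧
    ∀ᵐ x ∂(volume.restrict (Ioo a b)), -w x = f x (u x)

end CurvatureBV

end

noncomputable section

namespace CurvatureBV

/-! ### Integration against signed measures -/

/-! Write `g = f(·, u)`, extended by zero, let `a` be the density of the absolutely continuous part
of `Du`, and call `a / √(1 + a²)` the flux. Every test function used is the primitive of a measure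
`t + h dx` with a prescribed value `c` at `0⁺`. By Fubini the right-hand side becomes an integral of
`tail g` against that measure (`integral_mul_primitive`, `test_tail`), so the weak formulation
compares the flux with `tail g`.

Testing with densities of mean zero shows that the flux equals `W = tail g + m` almost everywhere
(`flux_ae_eq`). Since `g ≥ 0`, `W` is continuous and nonincreasing; since the flux is always below
`1` in modulus, `|W| < 1` at every interior point. Testing with the singular part `τ` of `Du` gives
`|τ|(0,1) = ∫ W dτ`, which forces `τ = 0` (`singPart_eq_zero`).

The endpoints need the divergent integrals. If `W(0) ≥ 1`, then `1 - |W|` is at most `M₀`, hence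
near `0` the slope `|a|` is at least a multiple of `1 / √M₀`. As `a` is integrable, this contradicts
divergence (`lintegral_one_div_sqrt_lt_top_of_flux`). The right endpoint is symmetric. Thus `|W| ≤ r
< 1` on `[0,1]`, and inverting the flux, `a = W / √(1 - W²)` is absolutely continuous, which gives
`W^{2,1}`. Finally, a boundary value that is not attained would force `|W| = 1` at that endpoint, by
testing with `1 - x` or `x`. -/

instance isFiniteMeasure_variation (μ : SignedMeasure ℝ) : IsFiniteMeasure μ.variation :=
  μ.totalVariation_eq_variation ▸ inferInstance

theorem posPart_le_variation (μ : SignedMeasure ℝ) :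
    μ.toJordanDecomposition.posPart ≤ μ.variation := by
  rw [← μ.totalVariation_eq_variation]
  exact Measure.le_add_right le_rfl

theorem negPart_le_variation (μ : SignedMeasure ℝ) :
    μ.toJordanDecomposition.negPart ≤ μ.variation := by
  rw [← μ.totalVariation_eq_variation]
  exact Measure.le_add_left le_rfl

theorem integral_toSignedMeasure_sub {p n : Measure ℝ} [IsFiniteMeasure p] [IsFiniteMeasure n]
    {f : ℝ → ℝ} (hp : Integrable f p) (hn : Integrable f n) :
    ∫ᵛ x, f x ∂<•(p.toSignedMeasure - n.toSignedMeasure) = ∫ x, f x ∂p - ∫ x, f x ∂n := by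
  rw [VectorMeasure.integral_sub_vectorMeasure (by rwa [VectorMeasure.Integrable, Measure.variation_toSignedMeasure])
    (by rwa [VectorMeasure.Integrable, Measure.variation_toSignedMeasure])]
  simp

theorem integral_eq_posPart_sub_negPart (μ : SignedMeasure ℝ) {f : ℝ → ℝ}
    (hf : Integrable f μ.variation) :
    ∫ᵛ x, f x ∂<•μ = ∫ x, f x ∂μ.toJordanDecomposition.posPart
      - ∫ x, f x ∂μ.toJordanDecomposition.negPart := by
  conv_lhs => rw [← μ.toSignedMeasure_toJordanDecomposition]
  exact integral_toSignedMeasure_sub (hf.mono_measure (posPart_le_variation μ))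
    (hf.mono_measure (negPart_le_variation μ))

theorem integral_withDensityᵥ {h F : ℝ → ℝ} (hh : Integrable h) (hF : Continuous F) {C : ℝ}
    (hC : ∀ x, |F x| ≤ C) :
    ∫ᵛ x, F x ∂<•(volume.withDensityᵥ h) = ∫ x, F x * h x := by
  have h1 := isFiniteMeasure_withDensity_ofReal hh.2
  have h2 := isFiniteMeasure_withDensity_ofReal hh.neg.2
  simp only [Pi.neg_apply] at h2
  rw [withDensityᵥ_eq_withDensity_pos_part_sub_withDensity_neg_part hh,
    integral_toSignedMeasure_sub (.of_bound hF.aestronglyMeasurable C (.of_forall hC))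
      (.of_bound hF.aestronglyMeasurable C (.of_forall hC))]
  rw [integral_withDensity_eq_integral_toReal_smul₀ hh.aemeasurable.ennreal_ofReal (by simp),
    integral_withDensity_eq_integral_toReal_smul₀ (f := fun x => ENNReal.ofReal (-h x))
      hh.neg.aemeasurable.ennreal_ofReal (by simp), ← integral_sub]
  · refine integral_congr_ae (.of_forall fun x => ?_)
    rcases le_total 0 (h x) with hx | hx
    · simp [ENNReal.toReal_ofReal, hx, ENNReal.ofReal_of_nonpos, mul_comm]
    · simp [ENNReal.toReal_ofReal, hx, ENNReal.ofReal_of_nonpos, mul_comm]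
  · simp only [smul_eq_mul, ENNReal.toReal_ofReal']
    exact hh.pos_part.mul_bdd hF.aestronglyMeasurable (.of_forall hC)
  · simp only [smul_eq_mul, ENNReal.toReal_ofReal']
    exact hh.neg.pos_part.mul_bdd hF.aestronglyMeasurable (.of_forall hC)

theorem variation_compl_eq_zero {η : SignedMeasure ℝ} {s : Set ℝ} (hs : MeasurableSet s)
    (hη : η.restrict s = η) : η.variation sᶜ = 0 := by
  rw [← hη, VectorMeasure.variation_restrict hs, Measure.restrict_apply hs.compl]
  simp

theorem posPart_compl_eq_zero {η : SignedMeasure ℝ} {s : Set ℝ} (hs : MeasurableSet s)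
    (hη : η.restrict s = η) : η.toJordanDecomposition.posPart sᶜ = 0 :=
  nonpos_iff_eq_zero.1 ((posPart_le_variation η _).trans (variation_compl_eq_zero hs hη).le)

theorem negPart_compl_eq_zero {η : SignedMeasure ℝ} {s : Set ℝ} (hs : MeasurableSet s)
    (hη : η.restrict s = η) : η.toJordanDecomposition.negPart sᶜ = 0 :=
  nonpos_iff_eq_zero.1 ((negPart_le_variation η _).trans (variation_compl_eq_zero hs hη).le)

/-! ### Primitives of signed measures -/

/-- The right-continuous function with distributional derivative `η` and value `c` at `-∞`. -/
def primitive (c : ℝ) (η : SignedMeasure ℝ) (x : ℝ) : ℝ := c + η (Iic x)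

/-- The tail integral `∫_y^1 g`. -/
def tail (g : ℝ → ℝ) (y : ℝ) : ℝ := ∫ x in y..1, g x

theorem continuous_tail {g : ℝ → ℝ} (hg : Integrable g) : Continuous (tail g) := by
  have : tail g = fun y => -∫ x in (1 : ℝ)..y, g x := by
    ext y; rw [tail, intervalIntegral.integral_symm]
  rw [this]
  exact (intervalIntegral.continuous_primitive (fun a b => hg.intervalIntegrable) 1).neg

theorem abs_tail_le {g : ℝ → ℝ} (hg : Integrable g) (y : ℝ) : |tail g y| ≤ ∫ x, |g x| := by
  refine (intervalIntegral.norm_integral_le_integral_norm_uIoc (f := g)).trans ?_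
  exact setIntegral_le_integral hg.norm (.of_forall fun _ => norm_nonneg _)

theorem measurable_measureReal_Iic (p : Measure ℝ) [IsFiniteMeasure p] :
    Measurable fun x => p.real (Iic x) :=
  Monotone.measurable fun _ _ h => measureReal_mono (Iic_subset_Iic.2 h)

/-- Fubini on the region `y ≤ x`, with `p` carried by `(0,1)`. -/
theorem integral_mul_measureReal_Iic {g : ℝ → ℝ} (hg : Integrable g) (p : Measure ℝ)
    [IsFiniteMeasure p] (hp : p (Ioo 0 1)ᶜ = 0) :
    ∫ x in Ioo (0 : ℝ) 1, g x * p.real (Iic x) = ∫ y, tail g y ∂p := by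
  have hm : MeasurableSet {z : ℝ × ℝ | z.2 ≤ z.1} := measurableSet_le measurable_snd measurable_fst
  have hint : Integrable (fun z : ℝ × ℝ => {z : ℝ × ℝ | z.2 ≤ z.1}.indicator (fun z => g z.1) z)
      ((volume.restrict (Ioo 0 1)).prod p) :=
    ((hg.integrableOn (s := Ioo 0 1)).comp_fst p).indicator hm
  have hsw := integral_integral_swap (f := fun x y =>
    {z : ℝ × ℝ | z.2 ≤ z.1}.indicator (fun z => g z.1) (x, y)) hint
  have h1 : ∀ x, ∫ y, {z : ℝ × ℝ | z.2 ≤ z.1}.indicator (fun z => g z.1) (x, y) ∂p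
      = g x * p.real (Iic x) := by
    intro x
    have : (fun y => {z : ℝ × ℝ | z.2 ≤ z.1}.indicator (fun z => g z.1) (x, y))
        = (Iic x).indicator fun _ => g x := by
      ext y; simp [indicator]
    rw [this, integral_indicator measurableSet_Iic]
    simp [mul_comm]
  simp only [h1] at hsw
  rw [hsw]
  refine integral_congr_ae ?_
  have : ∀ᵐ y ∂p, y ∈ Ioo (0 : ℝ) 1 := hp
  filter_upwards [this] with y hy
  have h2 : (fun x => {z : ℝ × ℝ | z.2 ≤ z.1}.indicator (fun z => g z.1) (x, y))
      = (Ici y).indicator g := by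
    ext x; simp [indicator]
  rw [h2, integral_indicator measurableSet_Ici, Measure.restrict_restrict measurableSet_Ici, tail,
    intervalIntegral.integral_of_le hy.2.le, ← integral_Ico_eq_integral_Ioc]
  congr 2
  ext x
  simp only [mem_inter_iff, mem_Ici, mem_Ioo, mem_Ico]
  exact ⟨fun h => ⟨h.1, h.2.2⟩, fun h => ⟨h.1, hy.1.trans_le h.1, h.2⟩⟩

theorem primitive_eq (c : ℝ) (η : SignedMeasure ℝ) (x : ℝ) :
    primitive c η x = c + (η.toJordanDecomposition.posPart.real (Iic x)
      - η.toJordanDecomposition.negPart.real (Iic x)) := by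
  rw [primitive, η.apply_eq_posPart_real_sub_negPart_real measurableSet_Iic]

theorem measurable_primitive (c : ℝ) (η : SignedMeasure ℝ) : Measurable (primitive c η) := by
  rw [funext (primitive_eq c η)]
  exact measurable_const.add
    ((measurable_measureReal_Iic _).sub (measurable_measureReal_Iic _))

theorem abs_primitive_le (c : ℝ) (η : SignedMeasure ℝ) (x : ℝ) :
    |primitive c η x| ≤ |c| + η.totalVariation.real univ := by
  refine (abs_add_le _ _).trans ?_
  gcongr
  exact (η.norm_le_totalVariation _).trans (measureReal_mono (subset_univ _))

/-- Integration by parts for a BV factor: it moves the right-hand side of the weak formulation onto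
the measure `η`. -/
theorem integral_mul_primitive {g : ℝ → ℝ} (hg : Integrable g) (c : ℝ) {η : SignedMeasure ℝ}
    (hη : η.restrict (Ioo 0 1) = η) :
    ∫ x in Ioo (0 : ℝ) 1, g x * primitive c η x = c * (∫ x in Ioo (0 : ℝ) 1, g x)
      + ∫ᵛ x, tail g x ∂<•η := by
  have hb : ∀ p : Measure ℝ, IsFiniteMeasure p →
      IntegrableOn (fun x => g x * p.real (Iic x)) (Ioo 0 1) := fun p _ =>
    hg.integrableOn.mul_bdd (c := p.real univ) (measurable_measureReal_Iic p).aestronglyMeasurable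
      (.of_forall fun x => by
        rw [Real.norm_of_nonneg measureReal_nonneg]; exact measureReal_mono (subset_univ _))
  have hadd := integral_add (hg.integrableOn.const_mul c)
    ((hb η.toJordanDecomposition.posPart inferInstance).sub
      (hb η.toJordanDecomposition.negPart inferInstance))
  simp only [Pi.sub_apply] at hadd
  rw [integral_eq_posPart_sub_negPart η (.of_bound (continuous_tail hg).aestronglyMeasurable _
      (.of_forall (abs_tail_le hg))),
    ← integral_mul_measureReal_Iic hg _ (posPart_compl_eq_zero measurableSet_Ioo hη),
    ← integral_mul_measureReal_Iic hg _ (negPart_compl_eq_zero measurableSet_Ioo hη),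
    ← integral_sub (hb _ inferInstance) (hb _ inferInstance), ← integral_const_mul,
    ← hadd]
  refine integral_congr_ae (.of_forall fun x => ?_)
  simp only [primitive_eq]
  ring

theorem IsTestFunction.integrable_deriv {a b : ℝ} {ψ : ℝ → ℝ} (hψ : IsTestFunction a b ψ) :
    Integrable (deriv ψ) :=
  (hψ.1.continuous_deriv (by simp)).integrable_of_hasCompactSupport hψ.2.1.deriv

theorem IsTestFunction.eq_zero {a b : ℝ} {ψ : ℝ → ℝ} (hψ : IsTestFunction a b ψ) {x : ℝ}
    (hx : x ∉ Ioo a b) : ψ x = 0 :=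
  image_eq_zero_of_notMem_tsupport fun h => hx (hψ.2.2 h)

theorem IsTestFunction.integral_deriv {a b : ℝ} {ψ : ℝ → ℝ} (hψ : IsTestFunction a b ψ) (x y : ℝ) :
    ∫ t in x..y, deriv ψ t = ψ y - ψ x :=
  intervalIntegral.integral_deriv_eq_sub
    (fun t _ => (hψ.1.differentiable (by simp)).differentiableAt)
    hψ.integrable_deriv.intervalIntegrable

theorem IsTestFunction.setIntegral_deriv {ψ : ℝ → ℝ} (hψ : IsTestFunction 0 1 ψ) :
    ∫ t in Ioo (0 : ℝ) 1, deriv ψ t = 0 := by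
  rw [← integral_Ioc_eq_integral_Ioo, ← intervalIntegral.integral_of_le zero_le_one,
    hψ.integral_deriv, hψ.eq_zero (by simp), hψ.eq_zero (by simp), sub_zero]

theorem hasMeasureDeriv_primitive (c : ℝ) {η : SignedMeasure ℝ}
    (hη : η.restrict (Ioo 0 1) = η) : HasMeasureDeriv 0 1 (primitive c η) η := by
  refine ⟨Integrable.of_bound (measurable_primitive c η).aestronglyMeasurable _
    (.of_forall (abs_primitive_le c η)), hη, fun ψ hψ => ?_⟩
  have := integral_mul_primitive hψ.integrable_deriv c hη
  rw [hψ.setIntegral_deriv, mul_zero, zero_add] at this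
  -- With `g = ψ'` the tail is `-ψ`, so integration by parts becomes the definition of the
  -- distributional derivative.
  have ht : tail (deriv ψ) = fun x => -ψ x := by
    ext x
    rw [tail, hψ.integral_deriv, hψ.eq_zero (x := 1) (by simp), zero_sub]
  rw [ht, VectorMeasure.integral_fun_neg] at this
  simpa only [mul_comm] using this

/-! ### One-sided traces -/

/-- Nonempty intervals have positive measure. This makes essential one-sided limits unique, so that
`limUnder` returns them. -/
instance neBot_nhdsGT_inf_ae (x : ℝ) : (𝓝[>] x ⊓ ae volume).NeBot := by
  rw [inf_neBot_iff]
  intro s hs t ht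
  obtain ⟨b, hb, hbs⟩ := mem_nhdsGT_iff_exists_Ioo_subset.1 hs
  by_contra hne
  have h0 : volume (Ioo x b) = 0 := measure_mono_null (fun y hy hyt => hne ⟨y, hbs hy, hyt⟩) ht
  simp only [Real.volume_Ioo, ENNReal.ofReal_eq_zero, sub_nonpos] at h0
  exact absurd h0 (not_le.2 hb)

instance neBot_nhdsLT_inf_ae (x : ℝ) : (𝓝[<] x ⊓ ae volume).NeBot := by
  rw [inf_neBot_iff]
  intro s hs t ht
  obtain ⟨b, hb, hbs⟩ := mem_nhdsLT_iff_exists_Ioo_subset.1 hs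
  by_contra hne
  have h0 : volume (Ioo b x) = 0 := measure_mono_null (fun y hy hyt => hne ⟨y, hbs hy, hyt⟩) ht
  simp only [Real.volume_Ioo, ENNReal.ofReal_eq_zero, sub_nonpos] at h0
  exact absurd h0 (not_le.2 hb)

theorem HasRightTrace.rightTrace_eq {v : ℝ → ℝ} {x l : ℝ} (h : HasRightTrace v x l) :
    rightTrace v x = l := h.limUnder_eq

theorem HasLeftTrace.leftTrace_eq {v : ℝ → ℝ} {x l : ℝ} (h : HasLeftTrace v x l) :
    leftTrace v x = l := h.limUnder_eq

/-- Dominated convergence of indicators, applied to each Jordan part. -/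
theorem tendsto_apply_of_indicator (η : SignedMeasure ℝ) {l : Filter ℝ} [l.IsCountablyGenerated]
    {S : ℝ → Set ℝ} {A : Set ℝ} (hS : ∀ x, MeasurableSet (S x)) (hA : MeasurableSet A)
    (h : ∀ y, ∀ᶠ x in l, (y ∈ S x ↔ y ∈ A)) : Tendsto (fun x => η (S x)) l (𝓝 (η A)) := by
  have key : ∀ p : Measure ℝ, IsFiniteMeasure p →
      Tendsto (fun x => p.real (S x)) l (𝓝 (p.real A)) := by
    intro p _
    have h1 : ∀ {B : Set ℝ}, MeasurableSet B → p.real B = ∫ y, B.indicator (fun _ => (1 : ℝ)) y ∂p :=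
      fun hB => by rw [integral_indicator hB]; simp
    rw [h1 hA]
    simp_rw [fun x => h1 (hS x)]
    refine tendsto_integral_filter_of_dominated_convergence (fun _ => (1 : ℝ))
      (.of_forall fun x => (measurable_const.indicator (hS x)).aestronglyMeasurable)
      (.of_forall fun x => .of_forall fun y => ?_) (integrable_const _) (.of_forall fun y => ?_)
    · by_cases hy : y ∈ S x <;> simp [hy]
    · refine tendsto_const_nhds.congr' ?_
      filter_upwards [h y] with x hx
      by_cases hy : y ∈ A
      · simp [hy, hx.2 hy]
      · simp [hy, mt hx.1 hy]
  rw [η.apply_eq_posPart_real_sub_negPart_real hA]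
  simp_rw [fun x => η.apply_eq_posPart_real_sub_negPart_real (hS x)]
  exact (key _ inferInstance).sub (key _ inferInstance)

theorem apply_eq_zero_of_disjoint {η : SignedMeasure ℝ} {s A : Set ℝ} (hs : MeasurableSet s)
    (hη : η.restrict s = η) (hA : A ⊆ sᶜ) : η A = 0 := by
  refine η.null_of_totalVariation_zero (measure_mono_null hA ?_)
  rw [η.totalVariation_eq_variation]
  exact variation_compl_eq_zero hs hη

theorem hasRightTrace_primitive (c : ℝ) {η : SignedMeasure ℝ} (hη : η.restrict (Ioo 0 1) = η) :
    HasRightTrace (primitive c η) 0 c := by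
  have h := tendsto_apply_of_indicator η (l := 𝓝[>] (0 : ℝ)) (S := Iic) (A := Iic 0)
    (fun _ => measurableSet_Iic) measurableSet_Iic fun y => by
      rcases le_or_gt y 0 with hy | hy
      · filter_upwards [self_mem_nhdsWithin] with x hx
        simp only [mem_Iic, hy, iff_true]
        exact hy.trans (le_of_lt hx)
      · filter_upwards [mem_nhdsWithin_of_mem_nhds (Iio_mem_nhds hy)] with x hx
        simp only [mem_Iic, not_le.2 hy, iff_false, not_le]
        exact hx
  rw [apply_eq_zero_of_disjoint (A := Iic 0) measurableSet_Ioo hη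
    fun y hy h => absurd h.1 (not_lt.2 hy)] at h
  have := (tendsto_const_nhds (x := c)).add h
  rw [add_zero] at this
  exact this.mono_left inf_le_left

theorem hasLeftTrace_primitive (c : ℝ) {η : SignedMeasure ℝ} (hη : η.restrict (Ioo 0 1) = η) :
    HasLeftTrace (primitive c η) 1 (c + η univ) := by
  have h := tendsto_apply_of_indicator η (l := 𝓝[<] (1 : ℝ)) (S := Iic) (A := Iio 1)
    (fun _ => measurableSet_Iic) measurableSet_Iio fun y => by
      rcases lt_or_ge y 1 with hy | hy
      · filter_upwards [mem_nhdsWithin_of_mem_nhds (Ioi_mem_nhds hy)] with x hx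
        simp only [mem_Iic, mem_Iio, hy, iff_true]
        exact le_of_lt hx
      · filter_upwards [self_mem_nhdsWithin] with x hx
        simp only [mem_Iic, mem_Iio, not_lt.2 hy, iff_false, not_le]
        exact lt_of_lt_of_le hx hy
  have hu : η univ = η (Iio 1) := by
    rw [← VectorMeasure.of_add_of_sdiff measurableSet_Iio MeasurableSet.univ (subset_univ (Iio 1)),
      apply_eq_zero_of_disjoint (A := univ \ Iio 1) measurableSet_Ioo hη
        fun y hy h => absurd h.2 hy.2, add_zero]
  rw [← hu] at h
  exact ((tendsto_const_nhds (x := c)).add h).mono_left inf_le_left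

/-! ### Lebesgue decomposition -/

theorem singPart_add_withDensityᵥ {t : SignedMeasure ℝ} {h : ℝ → ℝ}
    (ht : t ⟂ᵥ (volume : Measure ℝ).toENNRealVectorMeasure) :
    singPart (t + volume.withDensityᵥ h) = t :=
  (SignedMeasure.eq_singularPart t h ht rfl).symm

theorem acDensity_add_withDensityᵥ {t : SignedMeasure ℝ} {h : ℝ → ℝ} (hh : Integrable h)
    (ht : t ⟂ᵥ (volume : Measure ℝ).toENNRealVectorMeasure) :
    acDensity (t + volume.withDensityᵥ h) =ᵐ[volume] h :=
  (SignedMeasure.eq_rnDeriv t h hh ht rfl).symm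

theorem restrict_withDensityᵥ {h : ℝ → ℝ} (hh : Integrable h) {s : Set ℝ} (hs : MeasurableSet s)
    (h0 : ∀ x ∉ s, h x = 0) :
    (volume.withDensityᵥ h).restrict s = volume.withDensityᵥ h := by
  ext A hA
  rw [VectorMeasure.restrict_apply _ hs hA, withDensityᵥ_apply hh (hA.inter hs),
    withDensityᵥ_apply hh hA, ← setIntegral_indicator hs]
  congr 1
  ext x
  by_cases hx : x ∈ s <;> simp [hx, h0]

/-- Restricting the Lebesgue decomposition of `ν` to `s` yields another decomposition of `ν`;
uniqueness identifies the singular parts. -/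
theorem restrict_singPart {ν : SignedMeasure ℝ} {s : Set ℝ} (hs : MeasurableSet s)
    (hν : ν.restrict s = ν) : (singPart ν).restrict s = singPart ν := by
  have hd : ν = singPart ν + volume.withDensityᵥ (acDensity ν) :=
    (SignedMeasure.singularPart_add_withDensity_rnDeriv_eq (s := ν) (μ := volume)).symm
  have hi : Integrable (acDensity ν) := SignedMeasure.integrable_rnDeriv _ _
  refine SignedMeasure.eq_singularPart (μ := volume) (s := ν) _ (s.indicator (acDensity ν)) ?_ ?_
  · obtain ⟨u, hu, h1, h2⟩ := SignedMeasure.mutuallySingular_singularPart ν volume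
    refine VectorMeasure.MutuallySingular.mk u hu (fun t ht htm => ?_) fun t ht _ => h2 t ht
    rw [VectorMeasure.restrict_apply _ hs htm]
    exact h1 _ (inter_subset_left.trans ht)
  · conv_lhs => rw [← hν]
    conv_lhs => rw [hd]
    ext A hA
    rw [VectorMeasure.restrict_apply _ hs hA, add_apply, add_apply,
      VectorMeasure.restrict_apply _ hs hA, withDensityᵥ_apply hi (hA.inter hs),
      withDensityᵥ_apply (hi.indicator hs) hA, setIntegral_indicator hs]

end CurvatureBV

end

noncomputable section

namespace CurvatureBV

/-! ### The du Bois-Reymond lemma -/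

theorem IsTestFunction.exists_primitive {a b : ℝ} (hab : a < b) {θ : ℝ → ℝ}
    (hθ : IsTestFunction a b θ) (h0 : ∫ x, θ x = 0) :
    ∃ φ, IsTestFunction a b φ ∧ deriv φ = θ := by
  have hc : Continuous θ := hθ.1.continuous
  have hi : Integrable θ := hc.integrable_of_hasCompactSupport hθ.2.1
  -- The midpoint keeps `K` nonempty when `θ = 0`, so its extreme points `p` and `q` exist.
  set K : Set ℝ := insert ((a + b) / 2) (tsupport θ) with hK
  have hKc : IsCompact K := hθ.2.1.isCompact.insert _
  have hKne : K.Nonempty := insert_nonempty _ _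
  have hKs : K ⊆ Ioo a b := insert_subset ⟨by linarith, by linarith⟩ hθ.2.2
  obtain ⟨p, hpK, hp⟩ := hKc.exists_isLeast hKne
  obtain ⟨q, hqK, hq⟩ := hKc.exists_isGreatest hKne
  have hz : ∀ x, x ∉ K → θ x = 0 := fun x hx =>
    image_eq_zero_of_notMem_tsupport fun h => hx (mem_insert_of_mem _ h)
  have hd : ∀ x, HasDerivAt (fun x => ∫ t in a..x, θ t) (θ x) x := fun x =>
    intervalIntegral.integral_hasDerivAt_right hi.intervalIntegrable
      (hc.stronglyMeasurableAtFilter _ _) hc.continuousAt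
  have hderiv : deriv (fun x => ∫ t in a..x, θ t) = θ := funext fun x => (hd x).deriv
  have hout : ∀ x, x ∉ Icc p q → ∫ t in a..x, θ t = 0 := by
    intro x hx
    rcases lt_or_ge x p with h | h
    · refine intervalIntegral.integral_zero_ae (.of_forall fun t ht => hz t fun htK => ?_)
      have := (hKs hpK).1
      have h2 : t ≤ max a x := ht.2
      have h3 : max a x < p := max_lt this h
      exact absurd (hp htK) (not_le.2 (h2.trans_lt h3))
    · have hqx : q < x := lt_of_not_ge fun h' => hx ⟨h, h'⟩
      have hax : a ≤ x := ((hKs hqK).1.trans hqx).le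
      rw [intervalIntegral.integral_of_le hax, setIntegral_eq_integral_of_forall_compl_eq_zero, h0]
      intro t ht
      refine hz t fun htK => ht ⟨(hKs htK).1, (hq htK).trans hqx.le⟩
  have hts : tsupport (fun x => ∫ t in a..x, θ t) ⊆ Icc p q :=
    closure_minimal (fun x hx => by_contra fun h => hx (hout x h)) isClosed_Icc
  refine ⟨fun x => ∫ t in a..x, θ t, ⟨?_, ?_, ?_⟩, hderiv⟩
  · rw [contDiff_infty_iff_deriv]
    refine ⟨fun x => (hd x).differentiableAt, ?_⟩
    rw [hderiv]
    exact hθ.1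
  · exact isCompact_Icc.of_isClosed_subset (isClosed_tsupport _) hts
  · exact hts.trans fun x hx => ⟨(hKs hpK).1.trans_le hx.1, hx.2.trans_lt (hKs hqK).2⟩

theorem exists_isTestFunction_integral_eq_one {a b : ℝ} (hab : a < b) :
    ∃ ρ, IsTestFunction a b ρ ∧ ∫ x, ρ x = 1 := by
  let B : ContDiffBump ((a + b) / 2) :=
    ⟨(b - a) / 8, (b - a) / 4, by linarith, by linarith⟩
  refine ⟨B.normed volume, ⟨B.contDiff_normed, B.hasCompactSupport_normed, ?_⟩, B.integral_normed⟩
  rw [B.tsupport_normed_eq]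
  intro x hx
  rw [Metric.mem_closedBall, Real.dist_eq, abs_le] at hx
  have : B.rOut = (b - a) / 4 := rfl
  constructor <;> linarith [hx.1, hx.2]

/-- For a test function `ψ` of integral `m`, `ψ - m ρ` has mean zero and is therefore the derivative
of a test function. Hence `v - c` annihilates every `ψ`, where `c = ∫ v ρ`. -/
theorem ae_const_of_integral_mul_deriv_eq_zero {a b : ℝ} (hab : a < b) {v : ℝ → ℝ}
    (hv : IntegrableOn v (Ioo a b))
    (h : ∀ φ, IsTestFunction a b φ → ∫ x in Ioo a b, v x * deriv φ x = 0) :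
    ∃ c, ∀ᵐ x ∂(volume.restrict (Ioo a b)), v x = c := by
  obtain ⟨ρ, hρ, hρ1⟩ := exists_isTestFunction_integral_eq_one hab
  have hint : ∀ {ψ}, IsTestFunction a b ψ → Integrable ψ := fun hψ =>
    hψ.1.continuous.integrable_of_hasCompactSupport hψ.2.1
  have hvint : ∀ {ψ}, IsTestFunction a b ψ → IntegrableOn (fun x => v x * ψ x) (Ioo a b) := by
    intro ψ hψ
    obtain ⟨C, hC⟩ := hψ.1.continuous.bounded_above_of_compact_support hψ.2.1
    exact hv.mul_bdd hψ.1.continuous.aestronglyMeasurable (.of_forall hC)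
  have hset : ∀ {ψ}, IsTestFunction a b ψ → ∫ x in Ioo a b, ψ x = ∫ x, ψ x := fun hψ =>
    setIntegral_eq_integral_of_forall_compl_eq_zero fun x hx => hψ.eq_zero hx
  set c := ∫ x in Ioo a b, v x * ρ x
  refine ⟨c, ?_⟩
  have hz : ∀ᵐ x, x ∈ Ioo a b → v x - c = 0 := by
    refine isOpen_Ioo.ae_eq_zero_of_integral_contDiff_smul_eq_zero
      ((hv.sub (integrable_const c)).locallyIntegrableOn) fun ψ h1 h2 h3 => ?_
    have hψ : IsTestFunction a b ψ := ⟨h1, h2, h3⟩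
    set m := ∫ x, ψ x
    have hθ : IsTestFunction a b (fun x => ψ x - m * ρ x) := by
      refine ⟨hψ.1.sub (contDiff_const.mul hρ.1), hψ.2.1.sub (hρ.2.1.mul_left), ?_⟩
      refine (tsupport_sub ψ fun x => m * ρ x).trans (union_subset hψ.2.2 ?_)
      exact (tsupport_mul_subset_right (f := fun _ => m) (g := ρ)).trans hρ.2.2
    obtain ⟨φ, hφ, hφd⟩ := hθ.exists_primitive hab (by
      rw [integral_sub (hint hψ) ((hint hρ).const_mul m), integral_const_mul, hρ1]; simp [m])
    have h4 := h φ hφ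
    rw [hφd] at h4
    have h5 : ∫ x in Ioo a b, v x * (ψ x - m * ρ x)
        = (∫ x in Ioo a b, v x * ψ x) - m * c := by
      rw [← integral_const_mul, ← integral_sub (hvint hψ) ((hvint hρ).const_mul m)]
      congr 1; ext x; ring
    have h6 : ∫ x, ψ x • (v x - c) = ∫ x in Ioo a b, ψ x • (v x - c) :=
      (setIntegral_eq_integral_of_forall_compl_eq_zero fun x hx => by
        rw [hψ.eq_zero hx, zero_smul]).symm
    have h7 : ∫ x in Ioo a b, ψ x • (v x - c) = (∫ x in Ioo a b, v x * ψ x) - c * m := by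
      rw [show m = ∫ x in Ioo a b, ψ x from (hset hψ).symm, ← integral_const_mul, ← integral_sub (hvint hψ)
        ((hint hψ).integrableOn.const_mul c)]
      congr 1; ext x; simp only [smul_eq_mul]; ring
    rw [h6, h7]
    linarith
  rw [ae_restrict_iff' measurableSet_Ioo]
  filter_upwards [hz] with x hx hxm using sub_eq_zero.1 (hx hxm)

/-! ### Absolutely continuous functions -/

theorem _root_.AbsolutelyContinuousOnInterval.lipschitzOnWith_comp {W T : ℝ → ℝ} {a b : ℝ}
    (hW : AbsolutelyContinuousOnInterval W a b) {s : Set ℝ} {K : NNReal}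
    (hT : LipschitzOnWith K T s) (hs : MapsTo W (uIcc a b) s) :
    AbsolutelyContinuousOnInterval (fun x => T (W x)) a b := by
  rw [absolutelyContinuousOnInterval_iff] at hW ⊢
  intro ε hε
  -- `K + 1` avoids division by zero when the Lipschitz constant vanishes.
  obtain ⟨δ, hδ, h⟩ := hW (ε / (K + 1)) (by positivity)
  refine ⟨δ, hδ, fun E hE hlt => ?_⟩
  calc ∑ i ∈ Finset.range E.1, dist (T (W (E.2 i).1)) (T (W (E.2 i).2))
      ≤ ∑ i ∈ Finset.range E.1, K * dist (W (E.2 i).1) (W (E.2 i).2) :=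
        Finset.sum_le_sum fun i hi =>
          hT.dist_le_mul _ (hs (hE.1 i hi).1) _ (hs (hE.1 i hi).2)
    _ = K * ∑ i ∈ Finset.range E.1, dist (W (E.2 i).1) (W (E.2 i).2) :=
        (Finset.mul_sum _ _ _).symm
    _ ≤ (K + 1) * ∑ i ∈ Finset.range E.1, dist (W (E.2 i).1) (W (E.2 i).2) := by
        gcongr
        linarith
    _ < (K + 1) * (ε / (K + 1)) := by
        gcongr
        exact h E hE hlt
    _ = ε := by field_simp

theorem hasWeakDeriv_of_absolutelyContinuous {v V : ℝ → ℝ}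
    (hV : AbsolutelyContinuousOnInterval V 0 1)
    (hv : v =ᵐ[volume.restrict (Ioo 0 1)] V) : HasWeakDeriv 0 1 v (deriv V) := by
  have hVi : IntegrableOn V (Ioo 0 1) :=
    ((uIcc_of_le (zero_le_one (α := ℝ)) ▸ hV.continuousOn).integrableOn_compact
      isCompact_Icc).mono_set Ioo_subset_Icc_self
  have hdi : IntegrableOn (deriv V) (Ioo 0 1) :=
    ((intervalIntegrable_iff_integrableOn_Ioc_of_le zero_le_one).1
      hV.intervalIntegrable_deriv).mono_set Ioo_subset_Ioc_self
  refine ⟨IntegrableOn.locallyIntegrableOn (hVi.congr hv.symm), hdi.locallyIntegrableOn, fun ψ hψ => ?_⟩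
  have hψa : AbsolutelyContinuousOnInterval ψ 0 1 :=
    (hψ.1.of_le (by simp)).contDiffOn.absolutelyContinuousOnInterval
  have hp := hV.integral_mul_deriv_eq_deriv_mul hψa
  rw [hψ.eq_zero (x := 1) (by simp), hψ.eq_zero (x := 0) (by simp), mul_zero, mul_zero, sub_zero,
    zero_sub, intervalIntegral.integral_of_le zero_le_one,
    intervalIntegral.integral_of_le zero_le_one, integral_Ioc_eq_integral_Ioo,
    integral_Ioc_eq_integral_Ioo] at hp
  rw [← hp]
  refine integral_congr_ae ?_
  filter_upwards [hv] with x hx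
  rw [hx]

/-! ### The function `s / √(1 - s²)` -/

theorem one_sub_sq_div_sqrt (t : ℝ) : 1 - (t / √(1 + t ^ 2)) ^ 2 = 1 / (1 + t ^ 2) := by
  have h : 0 < 1 + t ^ 2 := by positivity
  rw [div_pow, Real.sq_sqrt h.le]
  field_simp
  ring

theorem abs_div_sqrt_lt_one (t : ℝ) : |t / √(1 + t ^ 2)| < 1 := by
  rw [← sq_lt_one_iff_abs_lt_one, ← sub_pos, one_sub_sq_div_sqrt]
  positivity

/-- This inverts the flux map and so recovers the slope from the flux. -/
theorem div_sqrt_one_sub_sq (t : ℝ) :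
    t / √(1 + t ^ 2) / √(1 - (t / √(1 + t ^ 2)) ^ 2) = t := by
  have h : 0 < √(1 + t ^ 2) := Real.sqrt_pos.2 (by positivity)
  rw [one_sub_sq_div_sqrt, Real.sqrt_div' _ (by positivity), Real.sqrt_one]
  field_simp

theorem exists_lipschitzOnWith_div_sqrt {r : ℝ} (hr : r < 1) :
    ∃ K, LipschitzOnWith K (fun s : ℝ => s / √(1 - s ^ 2)) (Icc (-r) r) := by
  refine ContDiffOn.exists_lipschitzOnWith (n := 1) ?_ (by simp) (convex_Icc _ _) isCompact_Icc
  intro s hs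
  have hpos : 0 < 1 - s ^ 2 := by nlinarith [hs.1, hs.2]
  refine ContDiffAt.contDiffWithinAt ?_
  refine contDiffAt_id.div ((contDiffAt_const.sub (contDiffAt_id.pow 2)).sqrt ?_) ?_
  · exact hpos.ne'
  · exact (Real.sqrt_pos.2 hpos).ne'

/-! ### Integrability of the slope forces a convergent integral -/

/-- On `N` the integrand is dominated by the integrable slope; off `N` it is bounded by `1 / √m` on
a set of finite measure. -/
theorem lintegral_one_div_sqrt_lt_top {S N : Set ℝ} {a M : ℝ → ℝ} {m : ℝ}
    (hS : volume S ≠ ⊤) (ha : IntegrableOn a N) (hm : 0 < m)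
    (hN : ∀ᵐ x ∂(volume.restrict N), 1 / √(M x) ≤ 4 * |a x|)
    (hfar : ∀ x ∈ S \ N, m ≤ M x) :
    ∫⁻ x in S, ENNReal.ofReal (1 / √(M x)) < ⊤ := by
  have h1 : ∫⁻ x in N, ENNReal.ofReal (1 / √(M x)) < ⊤ := by
    refine (lintegral_mono_ae (g := fun x => ‖4 * |a x|‖ₑ) ?_).trans_lt (ha.abs.const_mul 4).2
    filter_upwards [hN] with x hx
    rw [← ofReal_norm, Real.norm_of_nonneg (by positivity)]
    exact ENNReal.ofReal_le_ofReal hx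
  have h2 : ∫⁻ x in S \ N, ENNReal.ofReal (1 / √(M x)) < ⊤ := by
    refine (setLIntegral_mono (g := fun _ => ENNReal.ofReal (1 / √m)) measurable_const
      fun x hx => ENNReal.ofReal_le_ofReal ?_).trans_lt ?_
    · have := Real.sqrt_le_sqrt (hfar x hx)
      exact one_div_le_one_div_of_le (Real.sqrt_pos.2 hm) this
    · rw [setLIntegral_const]
      exact ENNReal.mul_lt_top ENNReal.ofReal_lt_top
        ((measure_mono sdiff_subset).trans_lt hS.lt_top)
  calc _ ≤ ∫⁻ x in N ∪ S \ N, ENNReal.ofReal (1 / √(M x)) :=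
        lintegral_mono_set fun x hx => by
          by_cases h : x ∈ N
          · exact .inl h
          · exact .inr ⟨hx, h⟩
    _ ≤ _ := lintegral_union_le _ _ _
    _ < ⊤ := ENNReal.add_lt_top.2 ⟨h1, h2⟩

/-- With `w` the flux, `1 - w² = (1 - |w|)(1 + |w|) ≤ 4M`, so `|a| = |w| / √(1 - w²) ≥ (1/2) /
(2√M)`; hence the factor `4`. -/
theorem one_div_sqrt_le_of_half_le {a M : ℝ} (hM : 0 < M)
    (h1 : 1 / 2 ≤ |a / √(1 + a ^ 2)|) (h2 : 1 - |a / √(1 + a ^ 2)| ≤ M) :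
    1 / √M ≤ 4 * |a| := by
  set w := a / √(1 + a ^ 2) with hw
  have hw1 : |w| < 1 := abs_div_sqrt_lt_one a
  have hp : 0 < 1 - w ^ 2 := by rw [← sq_abs]; nlinarith [abs_nonneg w]
  have ha : |a| = |w| / √(1 - w ^ 2) := by
    conv_lhs => rw [← div_sqrt_one_sub_sq a]
    rw [abs_div, abs_of_nonneg (Real.sqrt_nonneg _)]
  have h3 : √(1 - w ^ 2) ≤ 2 * √M := by
    rw [show (2 : ℝ) = √4 by rw [show (4 : ℝ) = 2 ^ 2 by norm_num]; simp,
      ← Real.sqrt_mul (by norm_num)]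
    refine Real.sqrt_le_sqrt ?_
    rw [← sq_abs]
    nlinarith [abs_nonneg w]
  have hs := Real.sqrt_pos.2 hp
  have hsM := Real.sqrt_pos.2 hM
  rw [ha, ← mul_div_assoc, div_le_div_iff₀ hsM hs]
  nlinarith

end CurvatureBV

end

noncomputable section

namespace CurvatureBV

/-! ### The singular part -/

/-- The Hahn decomposition provides a function `d = ±1` with `τ = d |τ|`, and uniqueness of the
density identifies it with `polarDensity τ`. -/
theorem polarDensity_ae_eq (τ : SignedMeasure ℝ) :
    (∀ᵐ x ∂τ.toJordanDecomposition.posPart, polarDensity τ x = 1) ∧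
      ∀ᵐ x ∂τ.toJordanDecomposition.negPart, polarDensity τ x = -1 := by
  obtain ⟨S, hS, -, -, hp, hn⟩ := τ.toJordanDecomposition.exists_compl_positive_negative
  set p := τ.toJordanDecomposition.posPart
  set n := τ.toJordanDecomposition.negPart
  set d : ℝ → ℝ := fun x => Sᶜ.indicator (fun _ => 1) x - S.indicator (fun _ => 1) x with hd
  have hdp : ∀ᵐ x ∂p, d x = 1 := by
    filter_upwards [measure_eq_zero_iff_ae_notMem.1 hp] with x hx
    simp [hd, hx]
  have hdn : ∀ᵐ x ∂n, d x = -1 := by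
    filter_upwards [measure_eq_zero_iff_ae_notMem.1 hn] with x hx
    have : x ∈ S := not_not.1 hx
    simp [hd, this]
  have hdm : Measurable d :=
    (measurable_const.indicator hS.compl).sub (measurable_const.indicator hS)
  have hdb : ∀ x, ‖d x‖ ≤ 1 := fun x => by by_cases hx : x ∈ S <;> simp [hd, hx]
  have hdi : ∀ q : Measure ℝ, IsFiniteMeasure q → Integrable d q := fun q _ =>
    .of_bound hdm.aestronglyMeasurable 1 (.of_forall hdb)
  have key : d =ᵐ[τ.totalVariation] polarDensity τ := by
    refine SignedMeasure.eq_rnDeriv 0 d (hdi _ inferInstance)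
      VectorMeasure.MutuallySingular.zero_left ?_
    rw [zero_add]
    ext A hA
    rw [withDensityᵥ_apply (hdi _ inferInstance) hA,
      τ.apply_eq_posPart_real_sub_negPart_real hA, SignedMeasure.totalVariation,
      Measure.restrict_add, integral_add_measure (hdi _ inferInstance) (hdi _ inferInstance),
      integral_congr_ae (ae_restrict_of_ae hdp), integral_congr_ae (ae_restrict_of_ae hdn)]
    simp [p, n, sub_eq_add_neg]
  have h1 : d =ᵐ[p] polarDensity τ := (Measure.absolutelyContinuous_of_le
    (Measure.le_add_right le_rfl)).ae_le key
  have h2 : d =ᵐ[n] polarDensity τ := (Measure.absolutelyContinuous_of_le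
    (Measure.le_add_left le_rfl)).ae_le key
  constructor
  · filter_upwards [hdp, h1] with x hx hx' using hx' ▸ hx
  · filter_upwards [hdn, h2] with x hx hx' using hx' ▸ hx

theorem integral_polarDensity (τ : SignedMeasure ℝ) :
    ∫ᵛ x, polarDensity τ x ∂<•τ = τ.toJordanDecomposition.posPart.real univ
      + τ.toJordanDecomposition.negPart.real univ := by
  have hi : Integrable (polarDensity τ) τ.totalVariation := SignedMeasure.integrable_rnDeriv _ _
  rw [integral_eq_posPart_sub_negPart τ (τ.totalVariation_eq_variation ▸ hi),
    integral_congr_ae (polarDensity_ae_eq τ).1, integral_congr_ae (polarDensity_ae_eq τ).2]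
  simp

/-- In terms of the Jordan parts, the equality reads `∫ (1 - W) dp + ∫ (1 + W) dn = 0`. Both
integrands are strictly positive on `s`, which carries `p` and `n`, so both measures vanish. -/
theorem eq_zero_of_integral_polarDensity_eq {τ : SignedMeasure ℝ} {s : Set ℝ}
    (hs : MeasurableSet s) (hτ : τ.restrict s = τ) {W : ℝ → ℝ} (hW : Continuous W) {C : ℝ}
    (hC : ∀ x, |W x| ≤ C) (hlt : ∀ x ∈ s, |W x| < 1)
    (h : ∫ᵛ x, polarDensity τ x ∂<•τ = ∫ᵛ x, W x ∂<•τ) : τ = 0 := by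
  have hi : ∀ q : Measure ℝ, IsFiniteMeasure q → Integrable W q := fun q _ =>
    .of_bound hW.aestronglyMeasurable C (.of_forall hC)
  rw [integral_polarDensity, integral_eq_posPart_sub_negPart τ (hi _ inferInstance)] at h
  have hps : ∀ᵐ x ∂τ.toJordanDecomposition.posPart, x ∈ s := posPart_compl_eq_zero hs hτ
  have hns : ∀ᵐ x ∂τ.toJordanDecomposition.negPart, x ∈ s := negPart_compl_eq_zero hs hτ
  have hA : ∀ A, MeasurableSet A → _ := fun A hA =>
    τ.apply_eq_posPart_real_sub_negPart_real (i := A) hA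
  set p := τ.toJordanDecomposition.posPart
  set n := τ.toJordanDecomposition.negPart
  have h1 : ∫ x, (1 - W x) ∂p = p.real univ - ∫ x, W x ∂p := by
    rw [integral_sub (integrable_const _) (hi _ inferInstance)]; simp
  have h2 : ∫ x, (1 + W x) ∂n = n.real univ + ∫ x, W x ∂n := by
    rw [integral_add (integrable_const _) (hi _ inferInstance)]; simp
  have hp0 : 0 ≤ᵐ[p] fun x => 1 - W x := by
    filter_upwards [hps] with x hx
    simpa using (abs_lt.1 (hlt x hx)).2.le
  have hn0 : 0 ≤ᵐ[n] fun x => 1 + W x := by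
    filter_upwards [hns] with x hx
    have := (abs_lt.1 (hlt x hx)).1
    simp only [Pi.zero_apply]
    linarith
  have hp1 : ∫ x, (1 - W x) ∂p = 0 := by
    linarith [integral_nonneg_of_ae hp0, integral_nonneg_of_ae hn0]
  have hn1 : ∫ x, (1 + W x) ∂n = 0 := by
    linarith [integral_nonneg_of_ae hp0, integral_nonneg_of_ae hn0]
  have hpz : p = 0 := by
    rw [← ae_eq_bot, ← eventually_false_iff_eq_bot]
    filter_upwards [(integral_eq_zero_iff_of_nonneg_ae hp0
      ((integrable_const _).sub (hi _ inferInstance))).1 hp1, hps] with x hx hxs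
    simp only [Pi.zero_apply] at hx
    linarith [(abs_lt.1 (hlt x hxs)).2]
  have hnz : n = 0 := by
    rw [← ae_eq_bot, ← eventually_false_iff_eq_bot]
    filter_upwards [(integral_eq_zero_iff_of_nonneg_ae hn0
      ((integrable_const _).add (hi _ inferInstance))).1 hn1, hns] with x hx hxs
    simp only [Pi.zero_apply] at hx
    linarith [(abs_lt.1 (hlt x hxs)).1]
  ext A hAm
  rw [hA A hAm, hpz, hnz]
  simp

/-! ### Monotone fluxes -/

theorem exists_mem_Ioo_of_ae {a b c d : ℝ} {P : ℝ → Prop}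
    (h : ∀ᵐ x ∂(volume.restrict (Ioo a b)), P x) (hcd : c < d) (hac : a ≤ c) (hdb : d ≤ b) :
    ∃ x ∈ Ioo c d, P x := by
  rw [ae_restrict_iff' measurableSet_Ioo] at h
  by_contra! hne
  have h0 : volume (Ioo c d) = 0 := measure_mono_null
    (fun x hx (hP : x ∈ Ioo a b → P x) => hne x hx (hP (Ioo_subset_Ioo hac hdb hx))) h
  simp only [Real.volume_Ioo, ENNReal.ofReal_eq_zero, sub_nonpos] at h0
  exact absurd h0 (not_le.2 hcd)

/-- Monotonicity turns the almost-everywhere bound into a pointwise one: squeeze `W x` between good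
points on either side. -/
theorem abs_lt_one_of_antitone {W : ℝ → ℝ} (hW : Antitone W)
    (h : ∀ᵐ x ∂(volume.restrict (Ioo 0 1)), |W x| < 1) {x : ℝ} (hx : x ∈ Ioo (0 : ℝ) 1) :
    |W x| < 1 := by
  obtain ⟨y, hy, hyW⟩ := exists_mem_Ioo_of_ae h hx.1 le_rfl hx.2.le
  obtain ⟨z, hz, hzW⟩ := exists_mem_Ioo_of_ae h hx.2 hx.1.le le_rfl
  exact abs_lt.2 ⟨(abs_lt.1 hzW).1.trans_le (hW hz.1.le), (hW hy.2.le).trans_lt (abs_lt.1 hyW).2⟩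

theorem tail_sub_tail {g : ℝ → ℝ} (hg : Integrable g) (x y : ℝ) :
    tail g x - tail g y = ∫ t in x..y, g t := by
  rw [tail, tail, sub_eq_iff_eq_add]
  exact (intervalIntegral.integral_add_adjacent_intervals hg.intervalIntegrable
    hg.intervalIntegrable).symm

theorem antitone_tail {g : ℝ → ℝ} (hg : Integrable g) (h0 : 0 ≤ᵐ[volume] g) :
    Antitone (tail g) := fun x y hxy => by
  rw [← sub_nonneg, tail_sub_tail hg]
  exact intervalIntegral.integral_nonneg_of_ae hxy h0

theorem absolutelyContinuous_tail {g : ℝ → ℝ} (hg : Integrable g) (m : ℝ) :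
    AbsolutelyContinuousOnInterval (fun x => tail g x + m) 0 1 := by
  have h := (hg.intervalIntegrable (a := 0)
    (b := 1)).absolutelyContinuousOnInterval_intervalIntegral (c := 1) (by simp)
  have hc : AbsolutelyContinuousOnInterval (fun _ : ℝ => m) 0 1 :=
    contDiff_const.contDiffOn.absolutelyContinuousOnInterval
  have : (fun x => tail g x + m) = fun x => m - ∫ t in (1 : ℝ)..x, g t := by
    ext x; rw [tail, intervalIntegral.integral_symm]; ring
  rw [this]
  exact hc.sub h

/-- Where `|W| > 1/2` the slope estimate applies. The remaining set lies in a compact set that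
avoids `e`, since `|W e| ≥ 1`, so `M` has a positive minimum there. The point `e` stands for either
endpoint. -/
theorem lintegral_one_div_sqrt_lt_top_of_flux {p q e : ℝ} {a W M : ℝ → ℝ}
    (ha : IntegrableOn a (Ioo p q)) (hW : Continuous W) (he : 1 ≤ |W e|)
    (haW : ∀ᵐ x ∂(volume.restrict (Ioo p q)), a x / √(1 + a x ^ 2) = W x)
    (hM : ContinuousOn M (Icc p q)) (hpos : ∀ x ∈ Icc p q, x ≠ e → 0 < M x)
    (hWM : ∀ x ∈ Ioo p q, 1 - |W x| ≤ M x) (hep : e ∉ Ioo p q) :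
    ∫⁻ x in Ioo p q, ENNReal.ofReal (1 / √(M x)) < ⊤ := by
  have hfarc : IsCompact (Icc p q ∩ {x | |W x| ≤ 1 / 2}) :=
    isCompact_Icc.inter_right (isClosed_le hW.abs continuous_const)
  obtain ⟨m, hm, hmM⟩ : ∃ m > 0, ∀ x ∈ Icc p q ∩ {x | |W x| ≤ 1 / 2}, m ≤ M x := by
    rcases eq_empty_or_nonempty (Icc p q ∩ {x | |W x| ≤ 1 / 2}) with h0 | hne
    · exact ⟨1, one_pos, fun x hx => absurd (h0 ▸ hx) (notMem_empty x)⟩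
    · obtain ⟨x, hx, hmin⟩ := hfarc.exists_isMinOn hne (hM.mono inter_subset_left)
      refine ⟨M x, hpos x hx.1 ?_, hmin⟩
      rintro rfl
      have : |W x| ≤ 1 / 2 := hx.2
      linarith
  have hNm : MeasurableSet (Ioo p q ∩ {x | 1 / 2 < |W x|}) :=
    measurableSet_Ioo.inter (isOpen_lt continuous_const hW.abs).measurableSet
  refine lintegral_one_div_sqrt_lt_top (N := Ioo p q ∩ {x | 1 / 2 < |W x|}) (a := a) (by simp)
    (ha.mono_set inter_subset_left) hm ?_ fun x hx => ?_
  · rw [ae_restrict_iff' measurableSet_Ioo] at haW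
    rw [ae_restrict_iff' hNm]
    filter_upwards [haW] with x hx hxN
    have hx' := hx hxN.1
    have hxe : x ≠ e := by rintro rfl; exact hep hxN.1
    exact one_div_sqrt_le_of_half_le (hpos x (Ioo_subset_Icc_self hxN.1) hxe)
      (hx' ▸ le_of_lt hxN.2) (hx' ▸ hWM x hxN.1)
  · exact hmM x ⟨Ioo_subset_Icc_self hx.1, show |W x| ≤ 1 / 2 from not_lt.1 fun h => hx.2 ⟨hx.1, h⟩⟩

/-! ### Testing the weak formulation with primitives -/

/-- The weak formulation in `IsBVSolutionDirichlet`, with `Du = ν`. -/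
def WeakFormulation (f : ℝ → ℝ → ℝ) (κ₀ κ₁ : ℝ) (u : ℝ → ℝ) (ν : SignedMeasure ℝ) : Prop :=
  ∀ (φ : ℝ → ℝ) (η : SignedMeasure ℝ), HasMeasureDeriv 0 1 φ η →
    (singPart η).totalVariation ≪ (singPart ν).totalVariation →
    (rightTrace u 0 = κ₀ → rightTrace φ 0 = 0) →
    (leftTrace u 1 = κ₁ → leftTrace φ 1 = 0) →
    (∫ x in Ioo (0 : ℝ) 1, acDensity ν x * acDensity η x / √(1 + acDensity ν x ^ 2))
      + (singPart η).integral (polarDensity (singPart ν)) (ContinuousLinearMap.lsmul ℝ ℝ).flip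
      + Real.sign (rightTrace u 0 - κ₀) * rightTrace φ 0
      + Real.sign (leftTrace u 1 - κ₁) * leftTrace φ 1
      = ∫ x in Ioo (0 : ℝ) 1, f x (u x) * φ x

/-- The flux `u' / √(1 + u'²)` built on the density of the absolutely continuous part. -/
def flux (ν : SignedMeasure ℝ) (x : ℝ) : ℝ := acDensity ν x / √(1 + acDensity ν x ^ 2)

theorem integrable_acDensity (ν : SignedMeasure ℝ) : Integrable (acDensity ν) :=
  SignedMeasure.integrable_rnDeriv _ _

theorem eq_singPart_add_withDensityᵥ (ν : SignedMeasure ℝ) :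
    ν = singPart ν + volume.withDensityᵥ (acDensity ν) :=
  (SignedMeasure.singularPart_add_withDensity_rnDeriv_eq (s := ν) (μ := volume)).symm

theorem measurable_flux (ν : SignedMeasure ℝ) : Measurable (flux ν) := by
  have : Measurable (acDensity ν) := SignedMeasure.measurable_rnDeriv _ _
  unfold flux
  fun_prop

variable {f : ℝ → ℝ → ℝ} {κ₀ κ₁ : ℝ} {u g : ℝ → ℝ} {ν : SignedMeasure ℝ}

/-- The admissible test function with singular derivative `t`, density `h` and initial trace `c`;
its trace at `1` is `c` plus the total mass. -/
theorem WeakFormulation.test_primitive (H : WeakFormulation f κ₀ κ₁ u ν)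
    (hgf : ∀ x ∈ Ioo (0 : ℝ) 1, g x = f x (u x)) {t : SignedMeasure ℝ}
    (ht : t ⟂ᵥ (volume : Measure ℝ).toENNRealVectorMeasure) (htr : t.restrict (Ioo 0 1) = t)
    (htν : t.totalVariation ≪ (singPart ν).totalVariation) {h : ℝ → ℝ} (hh : Integrable h)
    (h0 : ∀ x ∉ Ioo (0 : ℝ) 1, h x = 0) {c : ℝ} (hc0 : rightTrace u 0 = κ₀ → c = 0)
    (hc1 : leftTrace u 1 = κ₁ → c + (t univ + ∫ x in Ioo (0 : ℝ) 1, h x) = 0) :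
    (∫ x in Ioo (0 : ℝ) 1, flux ν x * h x) + (∫ᵛ x, polarDensity (singPart ν) x ∂<•t)
      + Real.sign (rightTrace u 0 - κ₀) * c
      + Real.sign (leftTrace u 1 - κ₁) * (c + (t univ + ∫ x in Ioo (0 : ℝ) 1, h x))
      = ∫ x in Ioo (0 : ℝ) 1, g x * primitive c (t + volume.withDensityᵥ h) x := by
  set η := t + volume.withDensityᵥ h with hη
  have hηr : η.restrict (Ioo 0 1) = η := by
    rw [hη, VectorMeasure.restrict_add, htr, restrict_withDensityᵥ hh measurableSet_Ioo h0]
  have hu : η univ = t univ + ∫ x in Ioo (0 : ℝ) 1, h x := by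
    rw [hη, add_apply, withDensityᵥ_apply hh MeasurableSet.univ, Measure.restrict_univ,
      setIntegral_eq_integral_of_forall_compl_eq_zero h0]
  have hr := (hasRightTrace_primitive c hηr).rightTrace_eq
  have hl := (hasLeftTrace_primitive c hηr).leftTrace_eq
  rw [hu] at hl
  have hs : singPart η = t := singPart_add_withDensityᵥ ht
  have key := H (primitive c η) η (hasMeasureDeriv_primitive c hηr) (by rwa [hs])
    (fun h => by rw [hr, hc0 h]) (fun h => by rw [hl, hc1 h])
  rw [hr, hl, hs] at key
  have hrhs : ∫ x in Ioo (0 : ℝ) 1, g x * primitive c η x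
      = ∫ x in Ioo (0 : ℝ) 1, f x (u x) * primitive c η x :=
    setIntegral_congr_fun measurableSet_Ioo fun x hx => by simp only [hgf x hx]
  rw [hrhs, ← key]
  congr 3
  refine integral_congr_ae (ae_restrict_of_ae ?_)
  filter_upwards [acDensity_add_withDensityᵥ hh ht] with x hx
  rw [hx, flux]
  ring

theorem WeakFormulation.test_tail (H : WeakFormulation f κ₀ κ₁ u ν)
    (hgf : ∀ x ∈ Ioo (0 : ℝ) 1, g x = f x (u x)) (hg : Integrable g) {t : SignedMeasure ℝ}
    (ht : t ⟂ᵥ (volume : Measure ℝ).toENNRealVectorMeasure) (htr : t.restrict (Ioo 0 1) = t)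
    (htν : t.totalVariation ≪ (singPart ν).totalVariation) {h : ℝ → ℝ} (hh : Integrable h)
    (h0 : ∀ x ∉ Ioo (0 : ℝ) 1, h x = 0) {c : ℝ} (hc0 : rightTrace u 0 = κ₀ → c = 0)
    (hc1 : leftTrace u 1 = κ₁ → c + (t univ + ∫ x in Ioo (0 : ℝ) 1, h x) = 0) :
    (∫ x in Ioo (0 : ℝ) 1, flux ν x * h x) + (∫ᵛ x, polarDensity (singPart ν) x ∂<•t)
      + Real.sign (rightTrace u 0 - κ₀) * c
      + Real.sign (leftTrace u 1 - κ₁) * (c + (t univ + ∫ x in Ioo (0 : ℝ) 1, h x))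
      = c * (∫ x in Ioo (0 : ℝ) 1, g x) + (∫ᵛ x, tail g x ∂<•t)
        + ∫ x in Ioo (0 : ℝ) 1, tail g x * h x := by
  have hb : ∀ μ : SignedMeasure ℝ, Integrable (tail g) μ.variation := fun μ =>
    .of_bound (continuous_tail hg).aestronglyMeasurable _ (.of_forall (abs_tail_le hg))
  rw [H.test_primitive hgf ht htr htν hh h0 hc0 hc1, integral_mul_primitive hg c (by
    rw [VectorMeasure.restrict_add, htr, restrict_withDensityᵥ hh measurableSet_Ioo h0]),
    VectorMeasure.integral_add_vectorMeasure (hb _) (hb _),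
    integral_withDensityᵥ hh (continuous_tail hg) (abs_tail_le hg), add_assoc,
    setIntegral_eq_integral_of_forall_compl_eq_zero (f := fun x => tail g x * h x)
      fun x hx => by rw [h0 x hx, mul_zero]]

/-- Let `k` be the flux minus `tail g`, with mean `m`. The density `k - m` has mean zero, so its
primitive vanishes at both ends and is admissible; testing with it gives `∫ (k - m)² = 0`. -/
theorem WeakFormulation.flux_ae_eq (H : WeakFormulation f κ₀ κ₁ u ν)
    (hgf : ∀ x ∈ Ioo (0 : ℝ) 1, g x = f x (u x)) (hg : Integrable g) :
    ∃ m, ∀ᵐ x ∂(volume.restrict (Ioo 0 1)), flux ν x = tail g x + m := by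
  set k : ℝ → ℝ := fun x => flux ν x - tail g x with hk
  have hkm : Measurable k := (measurable_flux ν).sub (continuous_tail hg).measurable
  have hkb : ∀ x, ‖k x‖ ≤ 1 + ∫ x, |g x| := fun x =>
    (norm_sub_le _ _).trans (add_le_add (abs_div_sqrt_lt_one _).le (abs_tail_le hg x))
  have hki : IntegrableOn k (Ioo 0 1) :=
    Integrable.of_bound hkm.aestronglyMeasurable _ (.of_forall hkb)
  set m := ∫ x in Ioo (0 : ℝ) 1, k x with hm
  have hone : ∀ c : ℝ, IntegrableOn (fun _ => c) (Ioo (0 : ℝ) 1) := fun c => integrable_const c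
  have hkmi : IntegrableOn (fun x => k x - m) (Ioo 0 1) := hki.sub (hone m)
  have hvol : ∫ _ in Ioo (0 : ℝ) 1, m = m := by simp
  have hmean : ∫ x in Ioo (0 : ℝ) 1, (k x - m) = 0 := by
    rw [integral_sub hki (hone m), hvol, ← hm, sub_self]
  have hmul : ∀ {F : ℝ → ℝ} {C : ℝ}, Measurable F → (∀ x, ‖F x‖ ≤ C) →
      IntegrableOn (fun x => F x * (k x - m)) (Ioo 0 1) := fun hF hC =>
    hkmi.bdd_mul hF.aestronglyMeasurable (.of_forall hC)
  have hind1 : ∫ x in Ioo (0 : ℝ) 1, (Ioo 0 1).indicator (fun x => k x - m) x = 0 := by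
    refine (setIntegral_congr_fun measurableSet_Ioo fun x hx => ?_).trans hmean
    exact indicator_of_mem hx _
  have key := H.test_tail hgf hg VectorMeasure.MutuallySingular.zero_left (by simp)
    (by rw [SignedMeasure.totalVariation_zero]; exact Measure.AbsolutelyContinuous.zero _)
    ((integrable_indicator_iff measurableSet_Ioo).2 hkmi)
    (fun x hx => indicator_of_notMem hx _) (c := 0) (fun _ => rfl)
    (fun _ => by rw [hind1]; simp)
  have hind : ∀ F : ℝ → ℝ, ∫ x in Ioo (0 : ℝ) 1, F x * (Ioo 0 1).indicator (fun x => k x - m) x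
      = ∫ x in Ioo (0 : ℝ) 1, F x * (k x - m) := fun F =>
    setIntegral_congr_fun measurableSet_Ioo fun x hx => by simp only [indicator_of_mem hx]
  rw [hind1, hind, hind] at key
  simp only [VectorMeasure.integral_zero_vectorMeasure, zero_apply, add_zero, mul_zero,
    zero_mul, zero_add] at key
  have hfl := hmul (measurable_flux ν) (fun x => (abs_div_sqrt_lt_one _).le)
  have htl := hmul (continuous_tail hg).measurable (abs_tail_le hg)
  have hsq : ∫ x in Ioo (0 : ℝ) 1, (k x - m) ^ 2 = 0 := by
    have h1 : ∀ x, (k x - m) ^ 2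
        = (flux ν x * (k x - m) - tail g x * (k x - m)) - m * (k x - m) := fun x => by
      simp only [hk]; ring
    simp only [h1]
    have hdl : IntegrableOn (fun x => flux ν x * (k x - m) - tail g x * (k x - m)) (Ioo 0 1) :=
      hfl.sub htl
    rw [integral_sub hdl (hkmi.const_mul m), integral_sub hfl htl, key,
      integral_const_mul, hmean]
    simp
  have hsqi : IntegrableOn (fun x => (k x - m) ^ 2) (Ioo 0 1) := by
    simp only [pow_two]
    refine hmul (C := (1 + ∫ x, |g x|) + ‖m‖) (hkm.sub measurable_const) fun x => ?_
    exact (norm_sub_le _ _).trans (add_le_add (hkb x) le_rfl)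
  refine ⟨m, ?_⟩
  filter_upwards [(integral_eq_zero_iff_of_nonneg (fun x => sq_nonneg _) hsqi).1 hsq] with x hx
  have hx0 : k x - m = 0 := by simpa using hx
  simp only [hk] at hx0
  linarith

end CurvatureBV

end

noncomputable section

namespace CurvatureBV

/-! ### Consequences of the flux identity: singular part, boundary signs, equation. -/

variable {f : ℝ → ℝ → ℝ} {κ₀ κ₁ : ℝ} {u g : ℝ → ℝ} {ν : SignedMeasure ℝ} {m : ℝ}

theorem integrable_indicator_const (c : ℝ) :
    Integrable ((Ioo (0 : ℝ) 1).indicator fun _ => c) :=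
  (integrable_indicator_iff measurableSet_Ioo).2 (integrable_const c)

theorem setIntegral_mul_indicator_const (F : ℝ → ℝ) (c : ℝ) :
    ∫ x in Ioo (0 : ℝ) 1, F x * (Ioo (0 : ℝ) 1).indicator (fun _ => c) x
      = (∫ x in Ioo (0 : ℝ) 1, F x) * c := by
  rw [← integral_mul_const]
  exact setIntegral_congr_fun measurableSet_Ioo fun x hx => by simp only [indicator_of_mem hx]

theorem setIntegral_indicator_const (c : ℝ) :
    ∫ x in Ioo (0 : ℝ) 1, (Ioo (0 : ℝ) 1).indicator (fun _ => c) x = c := by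
  simp

theorem setIntegral_flux (hg : Integrable g)
    (hm : ∀ᵐ x ∂(volume.restrict (Ioo 0 1)), flux ν x = tail g x + m) :
    ∫ x in Ioo (0 : ℝ) 1, flux ν x = (∫ x in Ioo (0 : ℝ) 1, tail g x) + m := by
  have ht : IntegrableOn (tail g) (Ioo 0 1) :=
    .of_bound (by simp) (continuous_tail hg).aestronglyMeasurable _ (.of_forall (abs_tail_le hg))
  rw [integral_congr_ae hm, integral_add ht (integrable_const _)]
  simp

theorem WeakFormulation.singPart_eq_zero (H : WeakFormulation f κ₀ κ₁ u ν)
    (hν : ν.restrict (Ioo 0 1) = ν)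
    (hgf : ∀ x ∈ Ioo (0 : ℝ) 1, g x = f x (u x)) (hg : Integrable g)
    (hm : ∀ᵐ x ∂(volume.restrict (Ioo 0 1)), flux ν x = tail g x + m)
    (hlt : ∀ x ∈ Ioo (0 : ℝ) 1, |tail g x + m| < 1) : singPart ν = 0 := by
  set τ := singPart ν with hτ
  have hτr : τ.restrict (Ioo 0 1) = τ := restrict_singPart measurableSet_Ioo hν
  have hWc : Continuous fun x => tail g x + m := (continuous_tail hg).add continuous_const
  refine eq_zero_of_integral_polarDensity_eq measurableSet_Ioo hτr hWc
    (C := (∫ x, |g x|) + |m|)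
    (fun x => (abs_add_le _ _).trans (add_le_add (abs_tail_le hg x) le_rfl)) hlt ?_
  -- The constant density `-τ(univ)` cancels the mass of `τ`, so both traces vanish and no boundary
  -- term survives.
  have key := H.test_tail hgf hg (t := τ) (SignedMeasure.mutuallySingular_singularPart ν volume) hτr
    Measure.AbsolutelyContinuous.rfl (integrable_indicator_const (-τ univ))
    (fun x hx => indicator_of_notMem hx _) (c := 0) (fun _ => rfl)
    (fun _ => by rw [setIntegral_indicator_const]; ring)
  rw [setIntegral_mul_indicator_const, setIntegral_mul_indicator_const,
    setIntegral_indicator_const, setIntegral_flux hg hm] at key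
  have hadd : ∫ᵛ x, (tail g x + m) ∂<•τ = (∫ᵛ x, tail g x ∂<•τ) + τ univ * m := by
    rw [VectorMeasure.integral_fun_add
      (.of_bound (continuous_tail hg).aestronglyMeasurable _ (.of_forall (abs_tail_le hg)))
      (integrable_const _), VectorMeasure.integral_const]
    simp [mul_comm]
  rw [hadd, hτ]
  linarith

theorem WeakFormulation.sign_rightTrace (H : WeakFormulation f κ₀ κ₁ u ν)
    (hgf : ∀ x ∈ Ioo (0 : ℝ) 1, g x = f x (u x)) (hg : Integrable g)
    (hm : ∀ᵐ x ∂(volume.restrict (Ioo 0 1)), flux ν x = tail g x + m)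
    (hne : rightTrace u 0 ≠ κ₀) : Real.sign (rightTrace u 0 - κ₀) = tail g 0 + m := by
  -- The test function is `1 - x`, admissible because the trace condition at `0` is vacuous.
  have key := H.test_tail hgf hg VectorMeasure.MutuallySingular.zero_left (by simp)
    (by rw [SignedMeasure.totalVariation_zero]; exact Measure.AbsolutelyContinuous.zero _)
    (integrable_indicator_const (-1)) (fun x hx => indicator_of_notMem hx _) (c := 1)
    (fun h => absurd h hne) (fun _ => by rw [setIntegral_indicator_const]; simp)
  rw [setIntegral_mul_indicator_const, setIntegral_mul_indicator_const,
    setIntegral_indicator_const, setIntegral_flux hg hm] at key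
  have h0 : tail g 0 = ∫ x in Ioo (0 : ℝ) 1, g x := by
    rw [tail, intervalIntegral.integral_of_le zero_le_one, integral_Ioc_eq_integral_Ioo]
  simp only [VectorMeasure.integral_zero_vectorMeasure, zero_apply] at key
  linarith

theorem WeakFormulation.sign_leftTrace (H : WeakFormulation f κ₀ κ₁ u ν)
    (hgf : ∀ x ∈ Ioo (0 : ℝ) 1, g x = f x (u x)) (hg : Integrable g)
    (hm : ∀ᵐ x ∂(volume.restrict (Ioo 0 1)), flux ν x = tail g x + m)
    (hne : leftTrace u 1 ≠ κ₁) : Real.sign (leftTrace u 1 - κ₁) = -(tail g 1 + m) := by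
  -- The test function is `x`.
  have key := H.test_tail hgf hg VectorMeasure.MutuallySingular.zero_left (by simp)
    (by rw [SignedMeasure.totalVariation_zero]; exact Measure.AbsolutelyContinuous.zero _)
    (integrable_indicator_const 1) (fun x hx => indicator_of_notMem hx _) (c := 0)
    (fun _ => rfl) (fun h => absurd h hne)
  rw [setIntegral_mul_indicator_const, setIntegral_mul_indicator_const,
    setIntegral_indicator_const, setIntegral_flux hg hm] at key
  have h1 : tail g 1 = 0 := intervalIntegral.integral_same
  simp only [VectorMeasure.integral_zero_vectorMeasure, zero_apply] at key
  linarith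

theorem WeakFormulation.integral_flux_mul_deriv (H : WeakFormulation f κ₀ κ₁ u ν)
    (hgf : ∀ x ∈ Ioo (0 : ℝ) 1, g x = f x (u x)) {ψ : ℝ → ℝ} (hψ : IsTestFunction 0 1 ψ) :
    ∫ x in Ioo (0 : ℝ) 1, flux ν x * deriv ψ x = ∫ x in Ioo (0 : ℝ) 1, g x * ψ x := by
  have hd := hψ.integrable_deriv
  have key := H.test_primitive hgf VectorMeasure.MutuallySingular.zero_left (by simp)
    (by rw [SignedMeasure.totalVariation_zero]; exact Measure.AbsolutelyContinuous.zero _)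
    hd (fun x hx => image_eq_zero_of_notMem_tsupport fun h =>
      hx (hψ.2.2 (tsupport_deriv_subset h))) (c := 0) (fun _ => rfl)
    (fun _ => by simp [hψ.setIntegral_deriv])
  have hp : ∀ x, primitive 0 (0 + volume.withDensityᵥ (deriv ψ)) x = ψ x := by
    intro x
    rw [primitive, zero_add, zero_add, withDensityᵥ_apply hd measurableSet_Iic]
    exact hψ.2.1.integral_Iic_deriv_eq (hψ.1.of_le (by simp)) x
  simp only [hp] at key
  simpa [hψ.setIntegral_deriv] using key

/-- `u` and a primitive of `ν` have the same derivative, so they differ by a constant. This is what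
makes the traces of `u` genuine limits. -/
theorem HasMeasureDeriv.exists_ae_eq_primitive (hu : HasMeasureDeriv 0 1 u ν) :
    ∃ c, ∀ᵐ x ∂(volume.restrict (Ioo 0 1)), u x = primitive c ν x := by
  have hp := hasMeasureDeriv_primitive 0 hu.2.1
  obtain ⟨c, hc⟩ := ae_const_of_integral_mul_deriv_eq_zero zero_lt_one (hu.1.sub hp.1)
    fun ψ hψ => by
      obtain ⟨C, hC⟩ := (hψ.1.continuous_deriv (by simp)).bounded_above_of_compact_support
        hψ.2.1.deriv
      have hm : AEStronglyMeasurable (deriv ψ) (volume.restrict (Ioo 0 1)) :=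
        hψ.integrable_deriv.1.restrict
      simp only [Pi.sub_apply, sub_mul]
      rw [integral_sub (hu.1.mul_bdd hm (.of_forall hC)) (hp.1.mul_bdd hm (.of_forall hC)),
        hu.2.2 ψ hψ, hp.2.2 ψ hψ, sub_self]
  refine ⟨c, ?_⟩
  filter_upwards [hc] with x hx
  simp only [Pi.sub_apply, primitive] at hx ⊢
  linarith

theorem HasRightTrace.congr_ae {v w : ℝ → ℝ} {a b l : ℝ} (hab : a < b)
    (h : HasRightTrace v a l) (hw : ∀ᵐ x ∂(volume.restrict (Ioo a b)), w x = v x) :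
    HasRightTrace w a l := by
  refine Tendsto.congr' ?_ h
  rw [ae_restrict_iff' measurableSet_Ioo] at hw
  filter_upwards [mem_inf_of_left (Ioo_mem_nhdsGT hab), mem_inf_of_right hw] with x hx hx'
  exact (hx' hx).symm

theorem HasLeftTrace.congr_ae {v w : ℝ → ℝ} {a b l : ℝ} (hab : a < b)
    (h : HasLeftTrace v b l) (hw : ∀ᵐ x ∂(volume.restrict (Ioo a b)), w x = v x) :
    HasLeftTrace w b l := by
  refine Tendsto.congr' ?_ h
  rw [ae_restrict_iff' measurableSet_Ioo] at hw
  filter_upwards [mem_inf_of_left (Ioo_mem_nhdsLT hab), mem_inf_of_right hw] with x hx hx'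
  exact (hx' hx).symm

/-! ### Strict flux bounds at the endpoints. -/

theorem setIntegral_le_of_ae_le {h : ℝ → ℝ} {a b x y : ℝ} (hg : Integrable g)
    (hh : IntegrableOn h (Ioo a b)) (hle : ∀ᵐ t ∂(volume.restrict (Ioo a b)), g t ≤ h t)
    (hax : a ≤ x) (hxy : x ≤ y) (hyb : y ≤ b) : ∫ t in x..y, g t ≤ ∫ t in x..y, h t := by
  rw [intervalIntegral.integral_of_le hxy, intervalIntegral.integral_of_le hxy,
    integral_Ioc_eq_integral_Ioo, integral_Ioc_eq_integral_Ioo]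
  have hs := Ioo_subset_Ioo hax hyb
  exact setIntegral_mono_ae_restrict hg.integrableOn (hh.mono_set hs)
    (ae_restrict_of_ae_restrict_of_subset hs hle)

/-- If `W(0) ≥ 1`, then `1 - |W(x)| ≤ W(0) - W(x) = ∫₀ˣ g ≤ M₀(x)`, and integrability of the slope
makes the divergent integral finite. -/
theorem tail_zero_lt_one {δ : ℝ} {μ₀ : ℝ → ℝ} (hg : Integrable g)
    (hm : ∀ᵐ x ∂(volume.restrict (Ioo 0 1)), flux ν x = tail g x + m)
    (hδ : 0 < δ) (hδ1 : δ ≤ 1) (hμ : IntegrableOn μ₀ (Ioo 0 δ))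
    (hle : ∀ᵐ x ∂(volume.restrict (Ioo 0 δ)), g x ≤ μ₀ x)
    (hpos : ∀ x ∈ Ioc 0 δ, 0 < ∫ t in (0 : ℝ)..x, μ₀ t)
    (htop : ∫⁻ x in Ioo 0 δ, ENNReal.ofReal (1 / √(∫ t in (0 : ℝ)..x, μ₀ t)) = ⊤) :
    tail g 0 + m < 1 := by
  by_contra! hge
  refine absurd htop (ne_of_lt ?_)
  have hμ' : IntegrableOn μ₀ (uIcc 0 δ) := by
    rwa [uIcc_of_le hδ.le, integrableOn_Icc_iff_integrableOn_Ioo]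
  refine lintegral_one_div_sqrt_lt_top_of_flux (e := 0) (a := acDensity ν)
    (W := fun x => tail g x + m) (integrable_acDensity ν).integrableOn
    ((continuous_tail hg).add continuous_const) (hge.trans (le_abs_self _))
    (ae_restrict_of_ae_restrict_of_subset (Ioo_subset_Ioo le_rfl hδ1) hm) ?_
    (fun x hx hne => hpos x ⟨lt_of_le_of_ne hx.1 (Ne.symm hne), hx.2⟩) (fun x hx => ?_) (by simp)
  · rw [← uIcc_of_le hδ.le]
    exact intervalIntegral.continuousOn_primitive_interval hμ'
  · have h1 := tail_sub_tail hg 0 x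
    have h2 := setIntegral_le_of_ae_le hg hμ hle le_rfl hx.1.le hx.2.le
    have h3 := le_abs_self (tail g x + m)
    linarith

theorem neg_one_lt_tail_one {δ : ℝ} {μ₁ : ℝ → ℝ} (hg : Integrable g)
    (hm : ∀ᵐ x ∂(volume.restrict (Ioo 0 1)), flux ν x = tail g x + m)
    (hδ : 0 < δ) (hδ1 : δ ≤ 1) (hμ : IntegrableOn μ₁ (Ioo (1 - δ) 1))
    (hle : ∀ᵐ x ∂(volume.restrict (Ioo (1 - δ) 1)), g x ≤ μ₁ x)
    (hpos : ∀ x ∈ Ico (1 - δ) 1, 0 < ∫ t in x..(1 : ℝ), μ₁ t)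
    (htop : ∫⁻ x in Ioo (1 - δ) 1, ENNReal.ofReal (1 / √(∫ t in x..(1 : ℝ), μ₁ t)) = ⊤) :
    -1 < tail g 1 + m := by
  by_contra! hge
  refine absurd htop (ne_of_lt ?_)
  have hδ' : 1 - δ ≤ 1 := by linarith
  have hμ' : IntegrableOn μ₁ (uIcc (1 - δ) 1) := by
    rwa [uIcc_of_le hδ', integrableOn_Icc_iff_integrableOn_Ioo]
  refine lintegral_one_div_sqrt_lt_top_of_flux (e := 1) (a := acDensity ν)
    (W := fun x => tail g x + m) (integrable_acDensity ν).integrableOn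
    ((continuous_tail hg).add continuous_const) (le_abs.2 (.inr (by linarith)))
    (ae_restrict_of_ae_restrict_of_subset (Ioo_subset_Ioo (by linarith) le_rfl) hm) ?_
    (fun x hx hne => hpos x ⟨hx.1, lt_of_le_of_ne hx.2 hne⟩) (fun x hx => ?_) (by simp)
  · rw [← uIcc_of_le hδ']
    exact intervalIntegral.continuousOn_primitive_interval_left hμ'
  · have h1 := tail_sub_tail hg x 1
    have h2 := setIntegral_le_of_ae_le hg hμ hle hx.1.le hx.2.le le_rfl
    have h3 := neg_le_abs (tail g x + m)
    linarith

theorem abs_sign_of_ne {x y : ℝ} (h : x ≠ y) : |Real.sign (x - y)| = 1 := by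
  rcases Real.sign_apply_eq_of_ne_zero _ (sub_ne_zero.2 h) with h | h <;> simp [h]

/-! ### Sobolev regularity and conclusion. -/

theorem hasWeakDeriv_acDensity (hu : HasMeasureDeriv 0 1 u ν) (h0 : singPart ν = 0) :
    HasWeakDeriv 0 1 u (acDensity ν) := by
  have hai := integrable_acDensity ν
  refine ⟨IntegrableOn.locallyIntegrableOn hu.1, hai.integrableOn.locallyIntegrableOn,
    fun ψ hψ => ?_⟩
  obtain ⟨C, hC⟩ := hψ.1.continuous.bounded_above_of_compact_support hψ.2.1
  have hd := eq_singPart_add_withDensityᵥ ν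
  rw [h0, zero_add] at hd
  rw [hu.2.2 ψ hψ]
  conv_lhs => rw [hd]
  rw [integral_withDensityᵥ hai hψ.1.continuous hC,
    setIntegral_eq_integral_of_forall_compl_eq_zero fun x hx => by rw [hψ.eq_zero hx, mul_zero]]
  simp only [mul_comm]

/-- The slope is `W / √(1 - W²)` almost everywhere: an absolutely continuous function composed with
a map that is Lipschitz on `[-r, r]`. -/
theorem hasWeakDeriv_acDensity_deriv (hg : Integrable g) {r : ℝ} (hr : r < 1)
    (hm : ∀ᵐ x ∂(volume.restrict (Ioo 0 1)), flux ν x = tail g x + m)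
    (hW : ∀ x ∈ Icc (0 : ℝ) 1, |tail g x + m| ≤ r) :
    ∃ v, HasWeakDeriv 0 1 (acDensity ν) v ∧ IntegrableOn v (Ioo 0 1) := by
  obtain ⟨K, hK⟩ := exists_lipschitzOnWith_div_sqrt hr
  have hV := (absolutelyContinuous_tail hg m).lipschitzOnWith_comp hK fun x hx =>
    abs_le.1 (hW x (by rwa [uIcc_of_le zero_le_one] at hx))
  refine ⟨_, hasWeakDeriv_of_absolutelyContinuous hV ?_,
    ((intervalIntegrable_iff_integrableOn_Ioc_of_le zero_le_one).1
      hV.intervalIntegrable_deriv).mono_set Ioo_subset_Ioc_self⟩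
  filter_upwards [hm] with x hx
  rw [← hx, flux, div_sqrt_one_sub_sq]

end CurvatureBV

end


theorem theorem4p1 (f : ℝ → ℝ → ℝ) (κ₀ κ₁ : ℝ) (u : ℝ → ℝ)
    (hu : CurvatureBV.IsBVSolutionDirichlet f κ₀ κ₁ u)
    (hk : ∀ᵐ x ∂(volume.restrict (Ioo (0 : ℝ) 1)), 0 ≤ f x (u x))
    (hkk : ∃ δ : ℝ, 0 < δ ∧ δ ≤ 1 ∧ ∃ μ₀ : ℝ → ℝ, IntegrableOn μ₀ (Ioo 0 δ) ∧
      (∀ᵐ x ∂(volume.restrict (Ioo 0 δ)), f x (u x) ≤ μ₀ x) ∧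
      (∀ x ∈ Ioc 0 δ, 0 < ∫ t in (0 : ℝ)..x, μ₀ t) ∧
      ∫⁻ x in Ioo 0 δ, ENNReal.ofReal (1 / √(∫ t in (0 : ℝ)..x, μ₀ t)) = ⊤)
    (hkkk : ∃ δ : ℝ, 0 < δ ∧ δ ≤ 1 ∧ ∃ μ₁ : ℝ → ℝ, IntegrableOn μ₁ (Ioo (1 - δ) 1) ∧
      (∀ᵐ x ∂(volume.restrict (Ioo (1 - δ) 1)), f x (u x) ≤ μ₁ x) ∧
      (∀ x ∈ Ico (1 - δ) 1, 0 < ∫ t in x..(1 : ℝ), μ₁ t) ∧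
      ∫⁻ x in Ioo (1 - δ) 1, ENNReal.ofReal (1 / √(∫ t in x..(1 : ℝ), μ₁ t)) = ⊤) :
    CurvatureBV.MemW21 0 1 u ∧ CurvatureBV.SolvesCurvatureEqAE 0 1 f u ∧
      CurvatureBV.HasRightTrace u 0 κ₀ ∧ CurvatureBV.HasLeftTrace u 1 κ₁ := by
  obtain ⟨hfi, ν, hν, H⟩ := hu
  replace H : CurvatureBV.WeakFormulation f κ₀ κ₁ u ν := H
  obtain ⟨δ₀, hδ₀, hδ₀1, μ₀, hμ₀, hle₀, hpos₀, htop₀⟩ := hkk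
  obtain ⟨δ₁, hδ₁, hδ₁1, μ₁, hμ₁, hle₁, hpos₁, htop₁⟩ := hkkk
  set g : ℝ → ℝ := (Ioo (0 : ℝ) 1).indicator fun x => f x (u x) with hgdef
  have hgf : ∀ x ∈ Ioo (0 : ℝ) 1, g x = f x (u x) := fun x hx => indicator_of_mem hx _
  have hg : Integrable g := (integrable_indicator_iff measurableSet_Ioo).2 hfi
  have hg0 : 0 ≤ᵐ[volume] g := by
    rw [ae_restrict_iff' measurableSet_Ioo] at hk
    filter_upwards [hk] with x hx
    exact indicator_apply_nonneg hx
  obtain ⟨m, hm⟩ := H.flux_ae_eq hgf hg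
  have hanti : Antitone fun x => CurvatureBV.tail g x + m :=
    fun x y hxy => by simpa using CurvatureBV.antitone_tail hg hg0 hxy
  have hlt : ∀ x ∈ Ioo (0 : ℝ) 1, |CurvatureBV.tail g x + m| < 1 := fun x hx =>
    CurvatureBV.abs_lt_one_of_antitone hanti
      (by filter_upwards [hm] with y hy; exact hy ▸ CurvatureBV.abs_div_sqrt_lt_one _) hx
  have hs := H.singPart_eq_zero hν.2.1 hgf hg hm hlt
  have hle₀' : ∀ᵐ x ∂(volume.restrict (Ioo 0 δ₀)), g x ≤ μ₀ x := by
    filter_upwards [hle₀, ae_restrict_mem measurableSet_Ioo] with x hx hxm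
    rwa [hgf x ⟨hxm.1, hxm.2.trans_le hδ₀1⟩]
  have hle₁' : ∀ᵐ x ∂(volume.restrict (Ioo (1 - δ₁) 1)), g x ≤ μ₁ x := by
    filter_upwards [hle₁, ae_restrict_mem measurableSet_Ioo] with x hx hxm
    rwa [hgf x ⟨(sub_nonneg.2 hδ₁1).trans_lt hxm.1, hxm.2⟩]
  have hW0 := CurvatureBV.tail_zero_lt_one hg hm hδ₀ hδ₀1 hμ₀ hle₀' hpos₀ htop₀
  have hW1 := CurvatureBV.neg_one_lt_tail_one hg hm hδ₁ hδ₁1 hμ₁ hle₁' hpos₁ htop₁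
  -- The endpoint conditions give only `W(0) < 1` and `W(1) > -1`; monotonicity supplies the two
  -- missing bounds.
  have h01 : CurvatureBV.tail g 1 + m ≤ CurvatureBV.tail g 0 + m := hanti zero_le_one
  have hW0' : |CurvatureBV.tail g 0 + m| < 1 := abs_lt.2 ⟨hW1.trans_le h01, hW0⟩
  have hW1' : |CurvatureBV.tail g 1 + m| < 1 := abs_lt.2 ⟨hW1, h01.trans_lt hW0⟩
  have hWr : ∀ x ∈ Icc (0 : ℝ) 1, |CurvatureBV.tail g x + m|
      ≤ max |CurvatureBV.tail g 0 + m| |CurvatureBV.tail g 1 + m| := fun x hx => by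
    rw [max_comm]
    exact abs_le_max_abs_abs (hanti hx.2) (hanti hx.1)
  have hr0 : CurvatureBV.rightTrace u 0 = κ₀ := by
    by_contra hne
    have h := CurvatureBV.abs_sign_of_ne hne
    rw [H.sign_rightTrace hgf hg hm hne] at h
    exact absurd h hW0'.ne
  have hl1 : CurvatureBV.leftTrace u 1 = κ₁ := by
    by_contra hne
    have h := CurvatureBV.abs_sign_of_ne hne
    rw [H.sign_leftTrace hgf hg hm hne, abs_neg] at h
    exact absurd h hW1'.ne
  obtain ⟨c, hc⟩ := hν.exists_ae_eq_primitive
  have htr0 := (CurvatureBV.hasRightTrace_primitive c hν.2.1).congr_ae zero_lt_one hc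
  have htr1 := (CurvatureBV.hasLeftTrace_primitive c hν.2.1).congr_ae zero_lt_one hc
  have hu' := CurvatureBV.hasWeakDeriv_acDensity hν hs
  obtain ⟨v, hv, hvi⟩ := CurvatureBV.hasWeakDeriv_acDensity_deriv hg (max_lt hW0' hW1') hm hWr
  refine ⟨⟨_, v, hu', hv, hν.1, (CurvatureBV.integrable_acDensity ν).integrableOn, hvi⟩,
    ⟨_, fun x => -g x, hu', ⟨?_, ?_, fun ψ hψ => ?_⟩, ?_⟩, ?_, ?_⟩
  · have hfl : IntegrableOn (CurvatureBV.flux ν) (Ioo 0 1) :=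
      Integrable.of_bound (CurvatureBV.measurable_flux ν).aestronglyMeasurable 1
        (.of_forall fun x => (CurvatureBV.abs_div_sqrt_lt_one _).le)
    exact IntegrableOn.locallyIntegrableOn hfl
  · exact hg.neg.integrableOn.locallyIntegrableOn
  · refine (H.integral_flux_mul_deriv hgf hψ).trans ?_
    simp only [neg_mul, integral_neg, neg_neg]
  · filter_upwards [ae_restrict_mem measurableSet_Ioo] with x hx
    rw [neg_neg, hgf x hx]
  -- `hr0` alone concerns the value of `limUnder`; `htr0` adds that the limit exists.
  · rwa [← hr0, htr0.rightTrace_eq]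
  · rwa [← hl1, htr1.leftTrace_eq]
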